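/- Let $\beta>1$ be real. Let $\tau_\beta(x)=\beta x-[\beta x]$ on $[0,1]$ be the beta-map, where $[y]$ denotes the integer part of $y$, and let $a_n(\beta,x)=[\beta\tau_\beta^{n-1}(x)]$, $n\ge 1$, be the digits of the greedy expansion of $x\in[0,1]$. Call $x\in[0,1]$ simple if $\tau_\beta^{m}(x)\in\{1/\beta,2/\beta,\dots,[\beta]/\beta\}$ for some integer $m\ge 0$, and non-simple otherwise. Let $BV$ be the space of functions $f:[0,1]\to\mathbb C$ of bounded variation with norm $\operatorname{var}(f)+\sup|f|$, let $\mathcal N\subset BV$ be the closed subspace of functions that vanish outside a countable set, and let $\mathcal L_\beta$ be the Perron-Frobenius operator on the quotient Banach space $BV/\mathcal N$, induced by $\mathcal L_\beta f(x)=\frac1\beta\sum_{y\in[0,1],\,\tau_\beta(y)=x}f(y)$. An isolated eigenvalue of $\mathcal L_\beta$ is an eigenvalue that is an isolated point of the spectrum of $\mathcal L_\beta$; a non-leading eigenvalue is an isolated eigenvalue $\lambda\neq 1$ with $|\lambda|>1/\beta$. Let $\lambda\in\mathbb C$ with $1/\beta<|\lambda|\le 1$, and define $F_\lambda:[0,1]\to\mathbb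 C$ by $$F_\lambda(x)=\sum_{n=1}^\infty\frac{a_n(\beta,x)}{(\beta\lambda)^n}.$$ Then: 1. $F_\lambda$ is right-continuous on $[0,1)$. 2. $F_\lambda$ is left-continuous at every non-simple $x\in(0,1]$. 3. $F_\lambda$ is left-continuous at every simple $x\in(0,1]$ if and only if $\lambda$ is an isolated eigenvalue of $\mathcal L_\beta$. Moreover, for each individual simple $x\in(0,1]$, $F_\lambda$ is left-continuous at $x$ if and only if $\lambda$ is an isolated eigenvalue of $\mathcal L_\beta$. 4. If $\lambda=1$, then $F_\lambda(x)=x$ for all $x\in[0,1]$; in particular $F_\lambda$ is differentiable on $[0,1]$. 5. If $\lambda$ is a non-leading eigenvalue of $\mathcal L_\beta$, then $F_\lambda$ is not Lipschitz continuous on $[0,1]$; indeed, for every $x\in[0,1]$ there are no constants $C,\delta>0$ such that $|F_\lambda(y)-F_\lambda(x)|\le C|y-x|$ for all $y\in[0,1]$ with $|y-x|<\delta$. In particular, $F_\lambda$ is differentiable at no point of $[0,1]$ (one-sided at the end points). -/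

import Mathlib

open Set Filter Topology

noncomputable section

namespace BetaMap

/-- The beta-map `τ_β(x) = βx - [βx]`; for `β > 1` it maps `[0, 1]` into itself. -/
def tau (β x : ℝ) : ℝ := Int.fract (β * x)

/-- The `n`-th digit `a_n(β, x) = [β τ_β^{n-1}(x)]` (`n ≥ 1`) of the greedy expansion of `x`. -/
def digit (β : ℝ) (n : ℕ) (x : ℝ) : ℕ := ⌊β * (tau β)^[n - 1] x⌋₊

/-- `x` is simple if some iterate `τ_β^m(x)`, `m ≥ 0`, lies in `{1/β, 2/β, …, [β]/β}`. -/
def IsSimplePoint (β x : ℝ) : Prop :=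
  ∃ m : ℕ, ∃ j ∈ Finset.Icc 1 ⌊β⌋₊, (tau β)^[m] x = (j : ℝ) / β

/-- `F_λ(x) = ∑_{n ≥ 1} a_n(β, x) / (βλ)^n`. -/
def F (β : ℝ) (lam : ℂ) (x : ℝ) : ℂ :=
  ∑' n : ℕ, (digit β (n + 1) x : ℂ) / ((β : ℂ) * lam) ^ (n + 1)

/-! ### The space `BV` of functions of bounded variation on `[0, 1]` -/

lemma eVariationOn_le_add_of_edist_le {f g h : unitInterval → ℂ} (c d : NNReal)
    (H : ∀ x y, edist (f x) (f y) ≤ c * edist (g x) (g y) + d * edist (h x) (h y)) :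
    eVariationOn f univ ≤ c * eVariationOn g univ + d * eVariationOn h univ := by
  refine iSup_le fun ⟨n, u, hu, us⟩ => ?_
  calc _ ≤ ∑ i ∈ Finset.range n, ((c : ENNReal) * edist (g (u (i + 1))) (g (u i))
          + d * edist (h (u (i + 1))) (h (u i))) := Finset.sum_le_sum fun i _ => H _ _
    _ = c * (∑ i ∈ Finset.range n, edist (g (u (i + 1))) (g (u i)))
          + d * ∑ i ∈ Finset.range n, edist (h (u (i + 1))) (h (u i)) := by
        rw [Finset.sum_add_distrib, Finset.mul_sum, Finset.mul_sum]
    _ ≤ _ := by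
        gcongr <;> exact eVariationOn.sum_le hu us

lemma eVariationOn_add_le (f g : unitInterval → ℂ) :
    eVariationOn (f + g) univ ≤ eVariationOn f univ + eVariationOn g univ := by
  have := eVariationOn_le_add_of_edist_le (f := f + g) (g := f) (h := g) 1 1
    (fun x y => by simpa using edist_add_add_le (f x) (g x) (f y) (g y))
  simpa using this

lemma eVariationOn_smul_le (c : ℂ) (f : unitInterval → ℂ) :
    eVariationOn (c • f) univ ≤ ‖c‖₊ * eVariationOn f univ := by
  have := eVariationOn_le_add_of_edist_le (f := c • f) (g := f) (h := f) ‖c‖₊ 0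
    (fun x y => by
      have h : edist (c • f x) (c • f y) = ‖c‖₊ • edist (f x) (f y) := edist_smul₀ c (f x) (f y)
      simpa [ENNReal.smul_def] using h.le)
  simpa using this

/-- The functions `[0, 1] → ℂ` of bounded variation, as a subspace of all functions. -/
def bvSubmodule : Submodule ℂ (unitInterval → ℂ) where
  carrier := {f | BoundedVariationOn f univ}
  add_mem' {f g} hf hg :=
    ne_top_of_le_ne_top (ENNReal.add_ne_top.2 ⟨hf, hg⟩) (eVariationOn_add_le f g)
  zero_mem' := by
    have : eVariationOn (0 : unitInterval → ℂ) univ = 0 :=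
      eVariationOn.constant_on (by rintro _ ⟨_, _, rfl⟩ _ ⟨_, _, rfl⟩; rfl)
    simp [BoundedVariationOn, this]
  smul_mem' c f hf :=
    ne_top_of_le_ne_top (ENNReal.mul_ne_top ENNReal.coe_ne_top hf) (eVariationOn_smul_le c f)

/-- The space `BV` of functions `[0, 1] → ℂ` of bounded variation. -/
structure BV : Type where
  toFun : unitInterval → ℂ
  boundedVariation : BoundedVariationOn toFun univ

instance : FunLike BV unitInterval ℂ := ⟨BV.toFun, fun f g h => by cases f; cases g; congr⟩

instance : Zero BV := ⟨⟨0, bvSubmodule.zero_mem⟩⟩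
instance : Add BV := ⟨fun f g => ⟨f + g, bvSubmodule.add_mem f.2 g.2⟩⟩
instance : Neg BV := ⟨fun f => ⟨-f, bvSubmodule.neg_mem f.2⟩⟩
instance : Sub BV := ⟨fun f g => ⟨f - g, bvSubmodule.sub_mem f.2 g.2⟩⟩
instance : SMul ℕ BV := ⟨fun n f => ⟨n • (f : unitInterval → ℂ), bvSubmodule.nsmul_mem f.2 n⟩⟩
instance : SMul ℤ BV := ⟨fun n f => ⟨n • (f : unitInterval → ℂ),
  bvSubmodule.toAddSubgroup.zsmul_mem f.2 n⟩⟩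
instance : SMul ℂ BV := ⟨fun c f => ⟨c • (f : unitInterval → ℂ), bvSubmodule.smul_mem c f.2⟩⟩

lemma BV.eVariationOn_ne_top (f : BV) : eVariationOn f univ ≠ ⊤ := f.2

lemma BV.coe_mk (f : unitInterval → ℂ) (hf : BoundedVariationOn f univ) :
    ((⟨f, hf⟩ : BV) : unitInterval → ℂ) = f := rfl
lemma BV.coe_zero : ((0 : BV) : unitInterval → ℂ) = 0 := rfl
lemma BV.coe_add (f g : BV) : ((f + g : BV) : unitInterval → ℂ) = f + g := rfl
lemma BV.coe_sub (f g : BV) : ((f - g : BV) : unitInterval → ℂ) = f - g := rfl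
lemma BV.coe_smul (c : ℂ) (f : BV) : ((c • f : BV) : unitInterval → ℂ) = c • ⇑f := rfl

instance : AddCommGroup BV :=
  (DFunLike.coe_injective (F := BV)).addCommGroup (fun f : BV => (f : unitInterval → ℂ)) rfl
    (fun _ _ => rfl) (fun _ => rfl) (fun _ _ => rfl) (fun _ _ => rfl) (fun _ _ => rfl)

/-- The coercion to functions, as an additive map. -/
def BV.coeHom : BV →+ (unitInterval → ℂ) where
  toFun f := f
  map_zero' := rfl
  map_add' _ _ := rfl

instance : Module ℂ BV :=
  (DFunLike.coe_injective (F := BV)).module ℂ BV.coeHom fun _ _ => rfl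

/-- The total variation `var f`, a finite number for `f` in `BV`. -/
def totalVar (f : BV) : ℝ := (eVariationOn f univ).toReal

/-- `‖f‖ = var f + sup |f|`. -/
instance : Norm BV := ⟨fun f => totalVar f + ⨆ x : unitInterval, ‖f x‖⟩

lemma BV.norm_def (f : BV) : ‖f‖ = totalVar f + ⨆ x : unitInterval, ‖f x‖ := rfl

lemma BV.bddAbove (f : BV) : BddAbove (range fun x : unitInterval => ‖f x‖) := by
  refine ⟨‖f 0‖ + totalVar f, ?_⟩
  rintro _ ⟨x, rfl⟩
  have h : dist (f x) (f 0) ≤ totalVar f :=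
    BoundedVariationOn.dist_le f.2 (mem_univ x) (mem_univ 0)
  rw [dist_eq_norm] at h
  have := norm_le_norm_add_norm_sub' (f x) (f 0)
  linarith

lemma BV.norm_apply_le_sup (f : BV) (x : unitInterval) : ‖f x‖ ≤ ⨆ y : unitInterval, ‖f y‖ :=
  le_ciSup (BV.bddAbove f) x

lemma BV.sup_nonneg (f : BV) : 0 ≤ ⨆ y : unitInterval, ‖f y‖ :=
  (norm_nonneg _).trans (BV.norm_apply_le_sup f 0)

lemma BV.totalVar_nonneg (f : BV) : 0 ≤ totalVar f := ENNReal.toReal_nonneg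

lemma BV.norm_apply_le (f : BV) (x : unitInterval) : ‖f x‖ ≤ ‖f‖ := by
  have := BV.norm_apply_le_sup f x
  have := BV.totalVar_nonneg f
  rw [BV.norm_def]; linarith

lemma totalVar_add_le (f g : BV) : totalVar (f + g) ≤ totalVar f + totalVar g := by
  have h := ENNReal.toReal_mono (ENNReal.add_ne_top.2 ⟨f.2, g.2⟩) (eVariationOn_add_le f g)
  rwa [ENNReal.toReal_add f.2 g.2] at h

lemma totalVar_smul_le (c : ℂ) (f : BV) : totalVar (c • f) ≤ ‖c‖ * totalVar f := by
  have h := ENNReal.toReal_mono (ENNReal.mul_ne_top ENNReal.coe_ne_top f.2)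
    (eVariationOn_smul_le c f)
  rwa [ENNReal.toReal_mul] at h

lemma BV.norm_smul_le' (c : ℂ) (f : BV) : ‖c • f‖ ≤ ‖c‖ * ‖f‖ := by
  rw [BV.norm_def, BV.norm_def, mul_add]
  refine add_le_add (totalVar_smul_le c f) (ciSup_le fun x => ?_)
  have : (c • f) x = c * f x := rfl
  rw [this, norm_mul]
  exact mul_le_mul_of_nonneg_left (BV.norm_apply_le_sup f x) (norm_nonneg c)

lemma BV.core : NormedSpace.Core ℂ BV where
  norm_nonneg f := add_nonneg (BV.totalVar_nonneg f) (BV.sup_nonneg f)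
  norm_smul c f := by
    refine le_antisymm (BV.norm_smul_le' c f) ?_
    rcases eq_or_ne c 0 with rfl | hc
    · rw [norm_zero, zero_mul]
      exact add_nonneg (BV.totalVar_nonneg _) (BV.sup_nonneg _)
    · have h := BV.norm_smul_le' c⁻¹ (c • f)
      rw [smul_smul, inv_mul_cancel₀ hc, one_smul, norm_inv] at h
      have hc' : 0 < ‖c‖ := norm_pos_iff.2 hc
      rwa [← div_eq_inv_mul, le_div_iff₀ hc', mul_comm] at h
  norm_triangle f g := by
    have h1 := totalVar_add_le f g
    have h2 : (⨆ x : unitInterval, ‖(f + g) x‖)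
        ≤ (⨆ x : unitInterval, ‖f x‖) + ⨆ x : unitInterval, ‖g x‖ :=
      ciSup_le fun x => (norm_add_le (f x) (g x)).trans
        (add_le_add (BV.norm_apply_le_sup f x) (BV.norm_apply_le_sup g x))
    simp only [BV.norm_def]
    linarith
  norm_eq_zero_iff f := by
    constructor
    · intro h
      refine DFunLike.ext _ _ fun x => ?_
      have := BV.norm_apply_le f x
      rw [h] at this
      exact norm_le_zero_iff.1 this
    · rintro rfl
      have := BV.norm_smul_le' 0 (0 : BV)
      simp only [smul_zero, norm_zero, zero_mul] at this
      exact le_antisymm this (add_nonneg (BV.totalVar_nonneg _) (BV.sup_nonneg _))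

instance : NormedAddCommGroup BV := NormedAddCommGroup.ofCore BV.core
instance : NormedSpace ℂ BV := NormedSpace.ofCore BV.core

/-! ### The quotient of `BV` by the functions that vanish off a countable set -/

/-- The functions in `BV` that vanish outside some countable set. -/
def nullBV : Submodule ℂ BV where
  carrier := {f | ∃ C : Set unitInterval, C.Countable ∧ ∀ x, x ∉ C → f x = 0}
  add_mem' := by
    rintro f g ⟨C, hC, hf⟩ ⟨D, hD, hg⟩
    refine ⟨C ∪ D, hC.union hD, fun x hx => ?_⟩
    rw [mem_union, not_or] at hx
    change f x + g x = 0
    rw [hf x hx.1, hg x hx.2, add_zero]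
  zero_mem' := ⟨∅, countable_empty, fun _ _ => rfl⟩
  smul_mem' := by
    rintro c f ⟨C, hC, hf⟩
    refine ⟨C, hC, fun x hx => ?_⟩
    change c * f x = 0
    rw [hf x hx, mul_zero]

instance isClosed_nullBV : IsClosed (nullBV : Set BV) := by
  refine isClosed_of_closure_subset fun f hf => ?_
  obtain ⟨u, hu, hlim⟩ := mem_closure_iff_seq_limit.1 hf
  choose C hC h using hu
  refine ⟨⋃ n, C n, countable_iUnion hC, fun x hx => ?_⟩
  have hx' : ∀ n, u n x = 0 := fun n => h n x fun hn => hx (mem_iUnion.2 ⟨n, hn⟩)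
  have hb : ∀ n, ‖f x‖ ≤ ‖f - u n‖ := fun n => by
    have h1 := BV.norm_apply_le (f - u n) x
    have h2 : (f - u n) x = f x - u n x := rfl
    rwa [h2, hx' n, sub_zero] at h1
  have ht : Tendsto (fun n => ‖f - u n‖) atTop (𝓝 0) := by
    have := (tendsto_const_nhds (x := f)).sub hlim |>.norm
    simpa using this
  exact norm_le_zero_iff.1 (ge_of_tendsto' ht hb)

/-- The Banach space `BV / 𝒩` with the quotient norm. -/
abbrev BVHat : Type := BV ⧸ nullBV

/-! ### The Perron-Frobenius operator -/

/-- `(ℒ_β f)(x) = (1/β) ∑_{τ_β(y) = x} f(y)`, the sum being over `y ∈ [0, 1]`. -/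
def transfer (β : ℝ) (f : unitInterval → ℂ) (x : unitInterval) : ℂ :=
  (1 / (β : ℂ)) * ∑ᶠ y ∈ {y : unitInterval | tau β y = x}, f y

/-- The candidate `(x + j)/β` for a preimage of `x`, cut off at the end points of `[0, 1]`. -/
def branch (β : ℝ) (j : ℕ) (x : unitInterval) : unitInterval :=
  projIcc 0 1 zero_le_one ((x + j) / β)

/-- The points whose preimage on the `j`-th branch exists. -/
def branchDom (β : ℝ) (j : ℕ) : Set unitInterval := {x | (x : ℝ) < 1 ∧ (x : ℝ) + j ≤ β}

lemma branch_coe {β : ℝ} (hβ : 1 < β) {j : ℕ} {x : unitInterval} (hx : x ∈ branchDom β j) :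
    (branch β j x : ℝ) = (x + j) / β := by
  have h0 : 0 < β := by linarith
  have : ((x : ℝ) + j) / β ∈ Icc (0 : ℝ) 1 :=
    ⟨div_nonneg (add_nonneg x.2.1 (Nat.cast_nonneg j)) h0.le, (div_le_one h0).2 hx.2⟩
  rw [branch, projIcc_of_mem zero_le_one this]

open Classical in
lemma finsum_fibre {β : ℝ} (hβ : 1 < β) (f : unitInterval → ℂ) (x : unitInterval) :
    ∑ᶠ y ∈ {y : unitInterval | tau β y = x}, f y
      = ∑ j ∈ Finset.range (⌊β⌋₊ + 1), (branchDom β j).indicator (f ∘ branch β j) x := by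
  have h0 : 0 < β := by linarith
  set J : Finset ℕ := (Finset.range (⌊β⌋₊ + 1)).filter fun j => x ∈ branchDom β j with hJ
  have himg : {y : unitInterval | tau β y = x} = (fun j => branch β j x) '' (J : Set ℕ) := by
    ext y
    simp only [mem_ofPred_eq, mem_image, Finset.mem_coe]
    have hy0 : 0 ≤ β * (y : ℝ) := mul_nonneg h0.le y.2.1
    constructor
    · intro hy
      have hf : (⌊β * (y : ℝ)⌋₊ : ℝ) + x = β * y := by
        rw [← hy, tau, natCast_floor_eq_intCast_floor hy0, Int.floor_add_fract]
      have hlt : (x : ℝ) < 1 := by rw [← hy]; exact Int.fract_lt_one _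
      have hle : β * (y : ℝ) ≤ β := by nlinarith [y.2.2]
      have hmem : x ∈ branchDom β ⌊β * (y : ℝ)⌋₊ := ⟨hlt, by linarith⟩
      refine ⟨⌊β * (y : ℝ)⌋₊, Finset.mem_filter.2 ⟨Finset.mem_range.2
        (Nat.lt_succ_of_le (Nat.floor_mono hle)), hmem⟩, ?_⟩
      apply Subtype.ext
      rw [branch_coe hβ hmem, div_eq_iff h0.ne']
      linarith
    · rintro ⟨j, hj, rfl⟩
      have hmem := (Finset.mem_filter.1 hj).2
      rw [tau, branch_coe hβ hmem, mul_div_cancel₀ _ h0.ne', Int.fract_add_natCast,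
        Int.fract_eq_self.2 ⟨x.2.1, hmem.1⟩]
  have hinj : InjOn (fun j => branch β j x) (J : Set ℕ) := by
    intro i hi j hj hij
    have h1 := congrArg (Subtype.val) hij
    simp only [branch_coe hβ (Finset.mem_filter.1 hi).2,
      branch_coe hβ (Finset.mem_filter.1 hj).2] at h1
    rw [div_left_inj' h0.ne', add_right_inj] at h1
    exact_mod_cast h1
  rw [himg, finsum_mem_image hinj, finsum_mem_coe_finset, hJ, Finset.sum_filter]
  exact Finset.sum_congr rfl fun j _ => by simp [indicator]

lemma eVariationOn_upper (S : Set unitInterval) (hS : IsLowerSet S) :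
    eVariationOn (Sᶜ.indicator (1 : unitInterval → ℝ)) univ ≤ 1 := by
  classical
  have hm : MonotoneOn (Sᶜ.indicator (1 : unitInterval → ℝ)) univ := by
    intro x _ y _ hxy
    by_cases hy : y ∈ S
    · have hx : x ∈ S := hS hxy hy
      simp [hx, hy]
    · simp only [indicator, mem_compl_iff, hy, not_false_eq_true, if_true]
      split_ifs <;> simp
  have h := hm.eVariationOn_eq (mem_univ 0) (mem_univ 1)
  have hu : (univ : Set unitInterval) ∩ Icc 0 1 = univ :=
    eq_univ_of_forall fun x => ⟨mem_univ x, x.2.1, x.2.2⟩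
  rw [hu] at h
  rw [h, ← ENNReal.ofReal_one]
  apply ENNReal.ofReal_le_ofReal
  simp only [indicator]
  split_ifs <;> simp

lemma eVariationOn_branch_le {β : ℝ} (hβ : 1 < β) (j : ℕ) (f : BV) :
    eVariationOn ((branchDom β j).indicator (f ∘ branch β j)) univ ≤ ENNReal.ofReal ‖f‖ := by
  classical
  have h0 : 0 < β := by linarith
  set S := branchDom β j
  have hS : IsLowerSet S := fun a b hba ha =>
    have : (b : ℝ) ≤ a := hba
    ⟨this.trans_lt ha.1, by have := ha.2; linarith⟩
  have hmono : Monotone (branch β j) := fun a b hab => by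
    have : (a : ℝ) ≤ b := hab
    exact monotone_projIcc _ (by gcongr)
  set M : NNReal := ⟨⨆ y : unitInterval, ‖f y‖, BV.sup_nonneg f⟩
  have hM : ∀ y, ‖f y‖ₑ ≤ M := fun y => by
    rw [enorm_eq_nnnorm]
    exact_mod_cast (BV.norm_apply_le_sup f y : ‖f y‖ ≤ _)
  have key : ∀ x y, edist (S.indicator (f ∘ branch β j) x) (S.indicator (f ∘ branch β j) y)
      ≤ edist (f (branch β j x)) (f (branch β j y))
        + M * edist (Sᶜ.indicator (1 : unitInterval → ℝ) x) (Sᶜ.indicator 1 y) := by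
    intro x y
    by_cases hx : x ∈ S <;> by_cases hy : y ∈ S
    · simp [hx, hy]
    · simp only [hx, hy, indicator_of_mem, indicator_of_notMem, not_false_eq_true, mem_compl_iff,
        not_true_eq_false, Pi.one_apply, Function.comp_apply, edist_zero_right]
      refine le_trans (hM _) (le_trans ?_ le_add_self)
      simp
    · simp only [hx, hy, indicator_of_mem, indicator_of_notMem, not_false_eq_true, mem_compl_iff,
        not_true_eq_false, Pi.one_apply, Function.comp_apply, edist_zero_left, edist_zero_right]
      refine le_trans (hM _) (le_trans ?_ le_add_self)
      simp
    · simp [hx, hy]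
  have hsum : eVariationOn (S.indicator (f ∘ branch β j)) univ
      ≤ eVariationOn (f ∘ branch β j) univ
        + M * eVariationOn (Sᶜ.indicator (1 : unitInterval → ℝ)) univ := by
    refine iSup_le fun ⟨n, u, hu, us⟩ => ?_
    refine (Finset.sum_le_sum fun i _ => key _ _).trans ?_
    rw [Finset.sum_add_distrib, ← Finset.mul_sum]
    exact add_le_add (eVariationOn.sum_le (f := f ∘ branch β j) hu us)
      (mul_le_mul_right (eVariationOn.sum_le hu us) _)
  have h1 : eVariationOn (f ∘ branch β j) univ ≤ ENNReal.ofReal (totalVar f) := by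
    rw [totalVar, ENNReal.ofReal_toReal f.eVariationOn_ne_top]
    exact eVariationOn.comp_le_of_monotoneOn f _ (hmono.monotoneOn _) (mapsTo_univ _ _)
  have h2 : (M : ENNReal) * eVariationOn (Sᶜ.indicator (1 : unitInterval → ℝ)) univ
      ≤ ENNReal.ofReal (⨆ y : unitInterval, ‖f y‖) := by
    calc _ ≤ (M : ENNReal) * 1 := mul_le_mul_right (eVariationOn_upper S hS) _
      _ = _ := by rw [mul_one]; exact (ENNReal.ofReal_eq_coe_nnreal _).symm
  refine hsum.trans ((add_le_add h1 h2).trans ?_)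
  rw [BV.norm_def, ENNReal.ofReal_add (BV.totalVar_nonneg f) (BV.sup_nonneg f)]

/-- One summand of the transfer operator, as an element of `BV`. -/
def branchBV {β : ℝ} (hβ : 1 < β) (j : ℕ) (f : BV) : BV :=
  ⟨(branchDom β j).indicator (f ∘ branch β j),
    ne_top_of_le_ne_top ENNReal.ofReal_ne_top (eVariationOn_branch_le hβ j f)⟩

lemma norm_branchBV_le {β : ℝ} (hβ : 1 < β) (j : ℕ) (f : BV) :
    ‖branchBV hβ j f‖ ≤ 2 * ‖f‖ := by
  have h1 : totalVar (branchBV hβ j f) ≤ ‖f‖ :=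
    ENNReal.toReal_le_of_le_ofReal (norm_nonneg f) (eVariationOn_branch_le hβ j f)
  have h2 : (⨆ x : unitInterval, ‖branchBV hβ j f x‖) ≤ ‖f‖ :=
    ciSup_le fun x => (norm_indicator_le_norm_self _ _).trans (BV.norm_apply_le f _)
  rw [BV.norm_def]
  linarith

lemma BV.sum_apply {ι : Type} (s : Finset ι) (g : ι → BV) (x : unitInterval) :
    (∑ i ∈ s, g i) x = ∑ i ∈ s, g i x := by
  classical
  induction s using Finset.induction_on with
  | empty => rfl
  | insert a s ha ih =>
    rw [Finset.sum_insert ha, Finset.sum_insert ha, ← ih]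
    rfl

lemma transfer_eq {β : ℝ} (hβ : 1 < β) (f : BV) :
    transfer β f = ((1 / (β : ℂ)) • ∑ j ∈ Finset.range (⌊β⌋₊ + 1), branchBV hβ j f : BV) := by
  funext x
  have h : ∀ (c : ℂ) (g : BV), (c • g) x = c * g x := fun _ _ => rfl
  rw [h, BV.sum_apply, transfer, finsum_fibre hβ]
  rfl

/-- The Perron-Frobenius operator as a bounded operator on `BV`. -/
def perronFrobeniusBV (β : ℝ) (hβ : 1 < β) : BV →L[ℂ] BV :=
  LinearMap.mkContinuous
    { toFun := fun f => ⟨transfer β f, by rw [transfer_eq hβ f]; exact BV.boundedVariation _⟩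
      map_add' := fun f g => DFunLike.ext _ _ fun x => by
        change transfer β (f + g : BV) x = transfer β f x + transfer β g x
        have h : ((f + g : BV) : unitInterval → ℂ) = fun y => f y + g y := rfl
        simp only [transfer, finsum_fibre hβ]
        rw [← mul_add, ← Finset.sum_add_distrib]
        refine congrArg _ (Finset.sum_congr rfl fun j _ => ?_)
        by_cases hx : x ∈ branchDom β j <;> simp [hx, h]
      map_smul' := fun c f => DFunLike.ext _ _ fun x => by
        change transfer β (c • f : BV) x = c * transfer β f x
        have h : ((c • f : BV) : unitInterval → ℂ) = fun y => c * f y := rfl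
        simp only [transfer, finsum_fibre hβ]
        rw [mul_left_comm]
        refine congrArg _ ?_
        rw [Finset.mul_sum]
        refine (Finset.sum_congr rfl fun j _ => ?_)
        by_cases hx : x ∈ branchDom β j <;> simp [hx, h] }
    (‖(1 / (β : ℂ))‖ * ((⌊β⌋₊ + 1 : ℕ) * 2))
    (fun f => by
      have h : ∀ p, (⟨transfer β f, p⟩ : BV)
          = (1 / (β : ℂ)) • ∑ j ∈ Finset.range (⌊β⌋₊ + 1), branchBV hβ j f :=
        fun p => DFunLike.coe_injective (transfer_eq hβ f)
      change ‖(⟨transfer β f, _⟩ : BV)‖ ≤ _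
      rw [h, norm_smul, mul_assoc]
      refine mul_le_mul_of_nonneg_left ?_ (norm_nonneg _)
      refine (norm_sum_le_of_le _ fun j _ => norm_branchBV_le hβ j f).trans ?_
      simp [mul_assoc])

lemma perronFrobeniusBV_apply (β : ℝ) (hβ : 1 < β) (f : BV) (x : unitInterval) :
    perronFrobeniusBV β hβ f x
      = (1 / (β : ℂ)) * ∑ᶠ y ∈ {y : unitInterval | tau β y = x}, f y := rfl

lemma nullBV_le_ker (β : ℝ) (hβ : 1 < β) :
    nullBV ≤ (nullBV.mkQL ∘L perronFrobeniusBV β hβ).ker := by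
  rintro f ⟨C, hC, hf⟩
  rw [LinearMap.mem_ker]
  refine (Submodule.Quotient.mk_eq_zero nullBV).2 ?_
  have hinj : Function.Injective (Subtype.val : unitInterval → ℝ) := Subtype.val_injective
  refine ⟨Subtype.val ⁻¹' ((fun y : unitInterval => tau β y) '' C),
    (hC.image _).preimage_of_injOn hinj.injOn, fun x hx => ?_⟩
  change perronFrobeniusBV β hβ f x = 0
  rw [perronFrobeniusBV_apply, finsum_mem_eq_zero_of_forall_eq_zero, mul_zero]
  intro y hy
  exact hf y fun hyC => hx ⟨y, hyC, hy⟩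

/-- The Perron-Frobenius operator `ℒ_β`, as a bounded operator on the quotient `BV / 𝒩`. -/
def perronFrobenius (β : ℝ) (hβ : 1 < β) : BVHat →L[ℂ] BVHat :=
  nullBV.liftQL (nullBV.mkQL ∘L perronFrobeniusBV β hβ) (nullBV_le_ker β hβ)

/-- `lam` is an eigenvalue of the bounded operator `T` and an isolated point of its spectrum. -/
def IsIsolatedEigenvalue {E : Type*} [NormedAddCommGroup E] [NormedSpace ℂ E]
    (T : E →L[ℂ] E) (lam : ℂ) : Prop :=
  Module.End.HasEigenvalue (T : Module.End ℂ E) lam ∧ ∀ᶠ z in 𝓝[≠] lam, z ∉ spectrum ℂ T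

/-- A non-leading eigenvalue of `ℒ_β`: an isolated eigenvalue of modulus greater than `1/β`,
other than the leading eigenvalue `1`. -/
def IsNonLeadingEigenvalue (β : ℝ) (hβ : 1 < β) (lam : ℂ) : Prop :=
  IsIsolatedEigenvalue (perronFrobenius β hβ) lam ∧ 1 / β < ‖lam‖ ∧ lam ≠ 1

end BetaMap

end

/-!
The key object is the value `F_z(1)`: for `|z| > 1/β`, both left-continuity of `F_z` at the simple
points and membership of `z` in the spectrum of `ℒ_β` are governed by the equation `F_z(1) = 1`.

*Spectrum.* Write `e_a` for the class of the indicator of `[0, a)` in `BV / 𝒩`. Then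
`ℒ e_a = (1/β) ([βa] e_1 + e_{τ(a)})` (`perronFrobenius_stepBV`). Subtracting from `ℒ` the rank-one
operator `f ↦ (ℒ f)(1-) e_1` leaves an operator `S` (`reducedOperator`) with `S e_a = (1/β) e_{τ(a)}`
which contracts the variation by the factor `1/β` (`exists_reducedOperator_mk`), so `z - S` is
invertible for `|z| > 1/β` by its Neumann series. Evaluating this series on `e_1` gives the digits of
`1`: the functional `f ↦ (ℒ f)(1-)` takes the value `F_z(1)` at `(z - S)⁻¹ e_1`
(`exists_resolvent_stepBV`). As `ℒ` is a rank-one perturbation of `S`, `z` is an eigenvalue if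
`F_z(1) = 1` and lies in the resolvent set otherwise. The solutions are isolated because `F_z(1)` is a
power series in `1/(βz)` without constant term; hence `isIsolatedEigenvalue_iff`.

*Continuity.* If the first `n` digits of `x` and `y` agree, then
`F(y) - F(x) = (βλ)^{-n} (F(τ^n y) - F(τ^n x))` (`F_sub_F_of_prefix`). All digits are locally constant
on the right, and on the left unless the orbit of `x` meets `0`. To the left of a simple point `x`
with `τ^{N+1}(x) = 0` one has `F(y) - F(x) = (βλ)^{-N-1} (F(1 - β^{N+1}(x - y)) - 1)`
(`HitsZeroAfter.eventually_F_sub`), so left-continuity at `x` means `F(1-) = 1`, whatever `x` is. This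
is equivalent to `F(1) = 1`: either `F` is left-continuous at `1`, or `1` is itself simple and the
identity at `x = 1` contracts the oscillation of `F` on the left of `1`.

*Lipschitz bounds.* If `|λ| = 1` and `F_λ(1) = 1`, comparison with the greedy expansion of `1` gives
`λ = 1`; so `|λ| < 1` for the non-leading eigenvalues. A Lipschitz bound at `x`, applied to the
truncated expansions of `x`, gives `F(τ^n x) = O(|λ|^n)`. Since `a_{n+1} = βλ F(τ^n x) - F(τ^{n+1} x)`
is an integer, the digits of `x` vanish eventually and the orbit of `x` reaches `0`. To the right of
such an `x`, increments of size `(β|λ|)^{-m}` occur over distances `β^{-m}`; at `x = 1` the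
self-similarity on the left of `1` produces the same contradiction.
-/

namespace BetaMap

/-! ### Completeness of `BV` -/

lemma BV.totalVar_le_norm (f : BV) : totalVar f ≤ ‖f‖ := by
  rw [BV.norm_def]; linarith [BV.sup_nonneg f]

lemma BV.norm_le_of_bounds {f : BV} {a b : ℝ} (ha : totalVar f ≤ a) (hb : ∀ x, ‖f x‖ ≤ b) :
    ‖f‖ ≤ a + b := by
  rw [BV.norm_def]
  exact add_le_add ha (ciSup_le hb)

instance BV.instCompleteSpace : CompleteSpace BV := by
  refine Metric.complete_of_cauchySeq_tendsto fun s hs => ?_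
  have hpt : ∀ x : unitInterval, ∃ l : ℂ, Tendsto (fun n => s n x) atTop (𝓝 l) := fun x => by
    refine cauchySeq_tendsto_of_complete ?_
    rw [Metric.cauchySeq_iff'] at hs ⊢
    intro ε hε
    obtain ⟨N, hN⟩ := hs ε hε
    refine ⟨N, fun n hn => lt_of_le_of_lt ?_ (hN n hn)⟩
    rw [dist_eq_norm, dist_eq_norm]
    exact BV.norm_apply_le (s n - s N) x
  choose g hg using hpt
  -- lower semicontinuity of the variation, applied to the tails of the sequence
  have hvar : ∀ ε > 0, ∃ N, ∀ n ≥ N,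
      eVariationOn (fun x => s n x - g x) univ ≤ ENNReal.ofReal ε ∧ ∀ x, ‖s n x - g x‖ ≤ ε := by
    intro ε hε
    obtain ⟨N, hN⟩ := Metric.cauchySeq_iff.1 hs ε hε
    refine ⟨N, fun n hn => ⟨?_, fun x => ?_⟩⟩
    · by_contra! h
      have hl := eVariationOn.lowerSemicontinuous_aux (p := atTop) (s := univ)
        (F := fun m x => s n x - s m x) (f := fun x => s n x - g x)
        (fun x _ => tendsto_const_nhds.sub (hg x)) h
      obtain ⟨m, hm, hmN⟩ := (hl.and (eventually_ge_atTop N)).exists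
      have h1 : eVariationOn (s n - s m : BV) univ ≤ ENNReal.ofReal ε := by
        rw [← ENNReal.ofReal_toReal (BV.eVariationOn_ne_top (s n - s m))]
        refine ENNReal.ofReal_le_ofReal ((BV.totalVar_le_norm _).trans ?_)
        rw [← dist_eq_norm]
        exact (hN n hn m hmN).le
      exact absurd h1 (not_le.2 hm)
    · refine le_of_tendsto ((tendsto_const_nhds.sub (hg x)).norm) ?_
      filter_upwards [eventually_ge_atTop N] with m hm
      refine (BV.norm_apply_le (s n - s m) x).trans ?_
      rw [← dist_eq_norm]
      exact (hN n hn m hm).le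
  obtain ⟨N, hN⟩ := hvar 1 one_pos
  have hgN : BoundedVariationOn (fun x => s N x - g x) univ :=
    ne_top_of_le_ne_top ENNReal.ofReal_ne_top (hN N le_rfl).1
  have hgBV : BoundedVariationOn g univ := by
    have := bvSubmodule.sub_mem (s N).2 hgN
    have hg' : (s N).toFun - (fun x => s N x - g x) = g := funext fun x => sub_sub_cancel _ _
    rwa [hg'] at this
  refine ⟨⟨g, hgBV⟩, Metric.tendsto_atTop.2 fun ε hε => ?_⟩
  obtain ⟨M, hM⟩ := hvar (ε / 3) (by positivity)
  refine ⟨M, fun n hn => ?_⟩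
  rw [dist_eq_norm]
  have h1 : totalVar (s n - ⟨g, hgBV⟩) ≤ ε / 3 :=
    ENNReal.toReal_le_of_le_ofReal (by positivity) (hM n hn).1
  have := BV.norm_le_of_bounds h1 (hM n hn).2
  linarith

/-! ### Rank-one perturbations -/

section RankOne

variable {E : Type*} [NormedAddCommGroup E] [NormedSpace ℂ E]

lemma isUnit_one_sub_smulRight (φ : E →L[ℂ] ℂ) (v : E) (h : φ v ≠ 1) :
    IsUnit (1 - φ.smulRight v : E →L[ℂ] E) := by
  have h' : 1 - φ v ≠ 0 := sub_ne_zero.2 h.symm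
  refine ⟨⟨1 - φ.smulRight v, 1 + (1 - φ v)⁻¹ • φ.smulRight v, ?_, ?_⟩, rfl⟩
  · ext x
    change (x + (1 - φ v)⁻¹ • φ x • v) - φ (x + (1 - φ v)⁻¹ • φ x • v) • v = x
    rw [map_add, map_smul, map_smul, smul_eq_mul, smul_eq_mul]
    match_scalars
    · simp
    · field_simp
      ring
  · ext x
    change (x - φ x • v) + (1 - φ v)⁻¹ • φ (x - φ x • v) • v = x
    rw [map_sub, map_smul, smul_eq_mul]
    match_scalars
    · simp
    · field_simp
      ring

/-- If `z - S` is invertible, `z - (S + φ ⊗ u)` factors as `(z - S)(1 - φ ⊗ v)`,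
where `v = (z - S)⁻¹ u`. -/
lemma algebraMap_sub_add_smulRight (S : E →L[ℂ] E) (φ : E →L[ℂ] ℂ) {u v : E} {z : ℂ}
    (hv : z • v - S v = u) :
    algebraMap ℂ (E →L[ℂ] E) z - (S + φ.smulRight u)
      = (algebraMap ℂ (E →L[ℂ] E) z - S) * (1 - φ.smulRight v) := by
  ext x
  simp only [Algebra.algebraMap_eq_smul_one]
  change z • x - (S x + φ x • u) = z • (x - φ x • v) - S (x - φ x • v)
  rw [map_sub, map_smul, ← hv]
  module

lemma notMem_spectrum_add_smulRight (S : E →L[ℂ] E) (φ : E →L[ℂ] ℂ) {u v : E} {z : ℂ}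
    (hS : IsUnit (algebraMap ℂ (E →L[ℂ] E) z - S)) (hv : z • v - S v = u) (h : φ v ≠ 1) :
    z ∉ spectrum ℂ (S + φ.smulRight u) := by
  rw [spectrum.notMem_iff, algebraMap_sub_add_smulRight S φ hv]
  exact hS.mul (isUnit_one_sub_smulRight φ v h)

lemma hasEigenvalue_add_smulRight (S : E →L[ℂ] E) (φ : E →L[ℂ] ℂ) {u v : E} {z : ℂ}
    (hv : z • v - S v = u) (h : φ v = 1) :
    Module.End.HasEigenvalue ((S + φ.smulRight u : E →L[ℂ] E) : Module.End ℂ E) z := by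
  refine Module.End.hasEigenvalue_of_hasEigenvector (x := v) ⟨?_, ?_⟩
  · rw [Module.End.mem_eigenspace_iff]
    change S v + φ v • u = z • v
    rw [h, ← hv]
    module
  · rintro rfl
    simp at h

lemma mem_spectrum_of_hasEigenvalue {T : E →L[ℂ] E} {z : ℂ}
    (h : Module.End.HasEigenvalue (T : Module.End ℂ E) z) : z ∈ spectrum ℂ T := by
  obtain ⟨v, hv⟩ := h.exists_hasEigenvector
  rw [spectrum.mem_iff]
  rintro ⟨w, hw⟩
  have hTv : T v = z • v := hv.apply_eq_smul
  have h0 : (algebraMap ℂ (E →L[ℂ] E) z - T) v = 0 := by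
    simp [Algebra.algebraMap_eq_smul_one, hTv]
  refine hv.2 ?_
  have h1 : ((↑w⁻¹ * ↑w : E →L[ℂ] E)) v = v := by rw [Units.inv_mul]; rfl
  rw [← h1, hw]
  change (↑w⁻¹ : E →L[ℂ] E) ((algebraMap ℂ (E →L[ℂ] E) z - T) v) = 0
  rw [h0, map_zero]

lemma smul_pow_apply (c : ℂ) (S : E →L[ℂ] E) (n : ℕ) (x : E) :
    ((c • S) ^ n) x = c ^ n • (S ^ n) x := by
  rw [smul_pow]
  rfl

/-- An operator whose powers decay like `r ^ n` has the Neumann series of its resolvent converging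
outside the disc of radius `r`. -/
lemma summable_inv_smul_pow [CompleteSpace E] {S : E →L[ℂ] E} {r K : ℝ}
    (hS : ∀ n, ‖S ^ n‖ ≤ K * r ^ n) (hr : 0 ≤ r) {z : ℂ} (hz : r < ‖z‖) :
    Summable fun n : ℕ => (z⁻¹ • S) ^ n := by
  have hz0 : 0 < ‖z‖ := hr.trans_lt hz
  refine Summable.of_norm_bounded (g := fun n => K * (r / ‖z‖) ^ n)
    ((summable_geometric_of_lt_one (by positivity) ((div_lt_one hz0).2 hz)).mul_left K) fun n => ?_
  rw [smul_pow, norm_smul, norm_pow, norm_inv, div_pow, inv_pow, div_eq_mul_inv,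
    mul_comm (‖z‖ ^ n)⁻¹, ← mul_assoc]
  gcongr
  exact hS n

end RankOne

/-! ### Step functions and the left limit at `1` on `BV / 𝒩` -/

lemma eVariationOn_step_le (a : ℝ) :
    eVariationOn (fun x : unitInterval => if (x : ℝ) < a then (1 : ℂ) else 0) univ ≤ 1 := by
  classical
  refine le_trans ?_ (eVariationOn_upper {x : unitInterval | (x : ℝ) < a}
    fun x y hyx hx => lt_of_le_of_lt (show (y : ℝ) ≤ x from hyx) hx)
  refine iSup_le fun ⟨n, u, hu, us⟩ => ?_
  refine (Finset.sum_le_sum fun i _ => ?_).trans (eVariationOn.sum_le hu us)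
  by_cases h1 : (u i : ℝ) < a <;> by_cases h2 : (u (i + 1) : ℝ) < a <;>
    simp [indicator, h1, h2]

/-- The indicator function of `[0, a) ∩ [0, 1]`, as an element of `BV`. -/
noncomputable def stepBV (a : ℝ) : BV :=
  ⟨fun x => if (x : ℝ) < a then 1 else 0,
    ne_top_of_le_ne_top ENNReal.one_ne_top (eVariationOn_step_le a)⟩

lemma stepBV_apply (a : ℝ) (x : unitInterval) :
    stepBV a x = if (x : ℝ) < a then 1 else 0 := rfl

lemma totalVar_stepBV_le (a : ℝ) : totalVar (stepBV a) ≤ 1 :=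
  ENNReal.toReal_le_of_le_ofReal zero_le_one
    (by rw [ENNReal.ofReal_one]; exact eVariationOn_step_le a)

lemma mk_eq_mk_of_eq_off_one {f g : BV} (h : ∀ x : unitInterval, (x : ℝ) < 1 → f x = g x) :
    (Submodule.Quotient.mk f : BVHat) = Submodule.Quotient.mk g := by
  refine (Submodule.Quotient.eq nullBV).2 ⟨{1}, countable_singleton 1, fun x hx => ?_⟩
  have hx1 : (x : ℝ) < 1 := lt_of_le_of_ne x.2.2 fun h1 => hx (Subtype.ext h1)
  exact sub_eq_zero.2 (h x hx1)

instance nhdsLT_one_neBot : (𝓝[<] (1 : unitInterval)).NeBot :=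
  nhdsLT_neBot_of_exists_lt ⟨0, zero_lt_one⟩

lemma BV.tendsto_leftLim_one (f : BV) :
    Tendsto f (𝓝[<] 1) (𝓝 (Function.leftLim f 1)) :=
  f.2.tendsto_leftLim 1

/-- The left limit at `1`, as a bounded functional on `BV`. -/
noncomputable def leftLimBV : BV →L[ℂ] ℂ :=
  LinearMap.mkContinuous
    { toFun := fun f => Function.leftLim f 1
      map_add' := fun f g => leftLim_eq_of_tendsto
        ((BV.tendsto_leftLim_one f).add (BV.tendsto_leftLim_one g))
      map_smul' := fun c f => leftLim_eq_of_tendsto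
        ((BV.tendsto_leftLim_one f).const_smul c) }
    1 fun f => by
      rw [one_mul]
      exact le_of_tendsto (BV.tendsto_leftLim_one f).norm
        (Eventually.of_forall fun x => BV.norm_apply_le f x)

lemma leftLimBV_eq_of_tendsto {f : BV} {l : ℂ} (h : Tendsto f (𝓝[<] 1) (𝓝 l)) :
    leftLimBV f = l := leftLim_eq_of_tendsto h

lemma frequently_notMem_of_countable {C : Set unitInterval} (hC : C.Countable) :
    ∃ᶠ x in 𝓝[<] (1 : unitInterval), x ∉ C := by
  rw [Filter.frequently_iff]
  intro U hU
  obtain ⟨a, ha, haU⟩ := (mem_nhdsLT_iff_exists_Ioo_subset' (zero_lt_one' unitInterval)).1 hU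
  have hC' : (Subtype.val '' C : Set ℝ).Countable := hC.image _
  obtain ⟨y, hy, hyC⟩ := (hC'.dense_compl ℝ).exists_mem_open isOpen_Ioo
    (nonempty_Ioo.2 (show (a : ℝ) < 1 from ha))
  have hy01 : y ∈ Icc (0 : ℝ) 1 := ⟨a.2.1.trans hyC.1.le, hyC.2.le⟩
  exact ⟨⟨y, hy01⟩, haU ⟨hyC.1, hyC.2⟩, fun h => hy ⟨_, h, rfl⟩⟩

lemma nullBV_le_ker_leftLimBV : nullBV ≤ leftLimBV.ker := by
  rintro f ⟨C, hC, hf⟩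
  by_contra h
  have hne : ∀ᶠ x in 𝓝[<] (1 : unitInterval), f x ≠ 0 :=
    (BV.tendsto_leftLim_one f).eventually_ne h
  obtain ⟨x, hx, hx'⟩ := ((frequently_notMem_of_countable hC).and_eventually hne).exists
  exact hx' (hf x hx)

/-- The left limit at `1`, as a bounded functional on `BV / 𝒩`. -/
noncomputable def leftLimHat : BVHat →L[ℂ] ℂ := nullBV.liftQL leftLimBV nullBV_le_ker_leftLimBV

lemma leftLimHat_mk (f : BV) : leftLimHat (Submodule.Quotient.mk f) = leftLimBV f := rfl

lemma perronFrobenius_mk {β : ℝ} (hβ : 1 < β) (f : BV) :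
    perronFrobenius β hβ (Submodule.Quotient.mk f)
      = Submodule.Quotient.mk (perronFrobeniusBV β hβ f) := rfl

open Classical in
lemma perronFrobeniusBV_apply_sum {β : ℝ} (hβ : 1 < β) (f : BV) (x : unitInterval) :
    perronFrobeniusBV β hβ f x = (1 / (β : ℂ)) *
      ∑ j ∈ Finset.range (⌊β⌋₊ + 1), (branchDom β j).indicator (f ∘ branch β j) x := by
  rw [perronFrobeniusBV_apply, finsum_fibre hβ]

lemma leftLimBV_stepBV_one : leftLimBV (stepBV 1) = 1 := by
  refine leftLimBV_eq_of_tendsto (tendsto_const_nhds.congr' ?_)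
  filter_upwards [self_mem_nhdsWithin] with x hx
  exact (if_pos (show (x : ℝ) < 1 from hx)).symm

/-! ### The action on step functions -/

/-- `ℒ 1_{[0,a)} = (1/β) ([βa] 1 + 1_{[0, τ(a))})` in `BV / 𝒩`. -/
lemma perronFrobenius_stepBV {β : ℝ} (hβ : 1 < β) {a : ℝ} (ha : a ∈ Icc (0 : ℝ) 1) :
    perronFrobenius β hβ (Submodule.Quotient.mk (stepBV a))
      = (1 / (β : ℂ)) • ((⌊β * a⌋₊ : ℂ) • Submodule.Quotient.mk (stepBV 1)
          + Submodule.Quotient.mk (stepBV (tau β a))) := by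
  classical
  have h0 : 0 < β := by linarith
  have hba : 0 ≤ β * a := mul_nonneg h0.le ha.1
  have hfl : (⌊β * a⌋₊ : ℝ) + tau β a = β * a := by
    rw [tau, natCast_floor_eq_intCast_floor hba, Int.floor_add_fract]
  have hle : β * a ≤ β := by nlinarith [ha.2]
  rw [perronFrobenius_mk]
  refine mk_eq_mk_of_eq_off_one (g := (1 / (β : ℂ)) • ((⌊β * a⌋₊ : ℂ) • stepBV 1
    + stepBV (tau β a))) fun x hx => ?_
  change _ = (1 / (β : ℂ)) * ((⌊β * a⌋₊ : ℂ) * stepBV 1 x + stepBV (tau β a) x)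
  rw [perronFrobeniusBV_apply_sum]
  congr 1
  have hterm : ∀ j : ℕ, (branchDom β j).indicator (stepBV a ∘ branch β j) x
      = if (x : ℝ) + j < β * a then (1 : ℂ) else 0 := by
    intro j
    by_cases hj : x ∈ branchDom β j
    · rw [indicator_of_mem hj, Function.comp_apply, stepBV_apply, branch_coe hβ hj]
      simp only [div_lt_iff₀' h0]
    · rw [indicator_of_notMem hj, if_neg]
      exact fun h => hj ⟨hx, by linarith⟩
  have hk : ⌊β * a⌋₊ ≤ ⌊β⌋₊ := Nat.floor_mono hle
  obtain ⟨d, hd⟩ := Nat.exists_eq_add_of_le hk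
  have htau1 : tau β a < 1 := Int.fract_lt_one _
  rw [Finset.sum_congr rfl fun j _ => hterm j, hd, add_assoc, Finset.sum_range_add,
    Finset.sum_range_succ', stepBV_apply, if_pos hx, mul_one, stepBV_apply]
  have e1 : ∀ j ∈ Finset.range ⌊β * a⌋₊,
      (if (x : ℝ) + j < β * a then (1 : ℂ) else 0) = 1 := fun j hj => by
    have : ((j + 1 : ℕ) : ℝ) ≤ ⌊β * a⌋₊ := Nat.cast_le.2 (Finset.mem_range.1 hj)
    push_cast at this
    have := Nat.floor_le hba
    exact if_pos (by linarith)
  have e2 : ∀ j ∈ Finset.range d,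
      (if (x : ℝ) + ((⌊β * a⌋₊ + (j + 1) : ℕ) : ℝ) < β * a then (1 : ℂ) else 0) = 0 :=
    fun j _ => by
      refine if_neg (not_lt.2 ?_)
      push_cast
      have := x.2.1
      have : (0 : ℝ) ≤ j := Nat.cast_nonneg j
      linarith
  rw [Finset.sum_congr rfl e1, Finset.sum_congr rfl e2]
  have e3 : (x : ℝ) + (⌊β * a⌋₊ : ℝ) < β * a ↔ (x : ℝ) < tau β a := by
    constructor <;> intro h <;> linarith
  simp only [Finset.sum_const, Finset.card_range, nsmul_eq_mul, mul_one, smul_zero, zero_add,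
    add_zero, e3]

/-! ### The contracting part of the Perron-Frobenius operator -/

/-- The functional `f ↦ (ℒ f)(1-)`. -/
noncomputable def boundaryFunctional (β : ℝ) (hβ : 1 < β) : BVHat →L[ℂ] ℂ :=
  leftLimHat ∘L perronFrobenius β hβ

/-- The operator `f ↦ ℒ f - (ℒ f)(1-) · 1`. In terms of the derivative measures it is the
push-forward under `τ_β`, divided by `β`. -/
noncomputable def reducedOperator (β : ℝ) (hβ : 1 < β) : BVHat →L[ℂ] BVHat :=
  perronFrobenius β hβ
    - (boundaryFunctional β hβ).smulRight (Submodule.Quotient.mk (stepBV 1) : BVHat)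

lemma boundaryFunctional_apply {β : ℝ} (hβ : 1 < β) (q : BVHat) :
    boundaryFunctional β hβ q = leftLimHat (perronFrobenius β hβ q) := rfl

lemma reducedOperator_apply {β : ℝ} (hβ : 1 < β) (q : BVHat) :
    reducedOperator β hβ q = perronFrobenius β hβ q
      - boundaryFunctional β hβ q • (Submodule.Quotient.mk (stepBV 1) : BVHat) := rfl

lemma reducedOperator_add_smulRight (β : ℝ) (hβ : 1 < β) :
    reducedOperator β hβ
      + (boundaryFunctional β hβ).smulRight (Submodule.Quotient.mk (stepBV 1) : BVHat)
      = perronFrobenius β hβ := sub_add_cancel _ _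

lemma leftLimBV_stepBV_of_lt {a : ℝ} (ha : a < 1) : leftLimBV (stepBV a) = 0 := by
  refine leftLimBV_eq_of_tendsto (tendsto_const_nhds.congr' ?_)
  have hmem : {x : unitInterval | a < (x : ℝ)} ∈ 𝓝[<] (1 : unitInterval) :=
    mem_nhdsWithin_of_mem_nhds
      ((isOpen_lt continuous_const continuous_subtype_val).mem_nhds (by simpa using ha))
  filter_upwards [hmem] with x hx
  exact (if_neg (not_lt.2 (le_of_lt hx))).symm

lemma boundaryFunctional_stepBV {β : ℝ} (hβ : 1 < β) {a : ℝ} (ha : a ∈ Icc (0 : ℝ) 1) :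
    boundaryFunctional β hβ (Submodule.Quotient.mk (stepBV a)) = (⌊β * a⌋₊ : ℂ) / β := by
  have htau1 : tau β a < 1 := Int.fract_lt_one _
  rw [boundaryFunctional_apply, perronFrobenius_stepBV hβ ha, map_smul, map_add, map_smul,
    leftLimHat_mk, leftLimHat_mk, leftLimBV_stepBV_one, leftLimBV_stepBV_of_lt htau1]
  simp only [smul_eq_mul]
  ring

lemma reducedOperator_stepBV {β : ℝ} (hβ : 1 < β) {a : ℝ} (ha : a ∈ Icc (0 : ℝ) 1) :
    reducedOperator β hβ (Submodule.Quotient.mk (stepBV a))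
      = (1 / (β : ℂ)) • Submodule.Quotient.mk (stepBV (tau β a)) := by
  rw [reducedOperator_apply, perronFrobenius_stepBV hβ ha, boundaryFunctional_stepBV hβ ha]
  module

lemma tau_mem_Icc (β x : ℝ) : tau β x ∈ Icc (0 : ℝ) 1 :=
  ⟨Int.fract_nonneg _, (Int.fract_lt_one _).le⟩

lemma iterate_tau_mem_Icc (β : ℝ) {x : ℝ} (hx : x ∈ Icc (0 : ℝ) 1) (n : ℕ) :
    (tau β)^[n] x ∈ Icc (0 : ℝ) 1 := by
  cases n with
  | zero => exact hx
  | succ n => rw [Function.iterate_succ_apply']; exact tau_mem_Icc _ _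

lemma reducedOperator_pow_stepBV {β : ℝ} (hβ : 1 < β) {a : ℝ} (ha : a ∈ Icc (0 : ℝ) 1) (n : ℕ) :
    (reducedOperator β hβ ^ n) (Submodule.Quotient.mk (stepBV a))
      = (1 / (β : ℂ)) ^ n • Submodule.Quotient.mk (stepBV ((tau β)^[n] a)) := by
  induction n with
  | zero => simp
  | succ n ih =>
    rw [pow_succ']
    change reducedOperator β hβ ((reducedOperator β hβ ^ n) _) = _
    rw [ih, map_smul, reducedOperator_stepBV hβ (iterate_tau_mem_Icc β ha n), smul_smul,
      ← pow_succ, Function.iterate_succ_apply']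

lemma branch_mono {β : ℝ} (hβ : 1 < β) (j : ℕ) : Monotone (branch β j) := fun a b hab => by
  have h0 : 0 < β := by linarith
  have : (a : ℝ) ≤ b := hab
  exact monotone_projIcc _ (by gcongr)

lemma sum_eVariationOn_comp_branch_le {β : ℝ} (hβ : 1 < β) (f : BV) (n : ℕ) :
    ∑ j ∈ Finset.range n, eVariationOn (f ∘ branch β j) univ ≤ eVariationOn f univ := by
  have h0 : 0 < β := by linarith
  set I : ℕ → unitInterval := fun j => projIcc 0 1 zero_le_one ((j : ℝ) / β) with hI
  have hmono : Monotone I := fun i j hij => by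
    have : (i : ℝ) ≤ j := Nat.cast_le.2 hij
    exact monotone_projIcc _ (by gcongr)
  calc _ ≤ ∑ j ∈ Finset.range n, eVariationOn f (Icc (I j) (I (j + 1))) := by
        refine Finset.sum_le_sum fun j _ => ?_
        refine eVariationOn.comp_le_of_monotoneOn _ _ ((branch_mono hβ j).monotoneOn _) fun x _ => ?_
        have hx0 := x.2.1
        have hx1 := x.2.2
        refine ⟨monotone_projIcc _ ?_, monotone_projIcc _ ?_⟩
        · exact div_le_div_of_nonneg_right (by linarith) h0.le
        · push_cast
          exact div_le_div_of_nonneg_right (by linarith) h0.le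
    _ = _ := eVariationOn.sum' _ hmono
    _ ≤ _ := eVariationOn.mono _ (subset_univ _)

/-- Off `1`, the constraint `y ≤ 1` in the fibre sum may be dropped for functions vanishing at `1`,
because `branch` sends the points beyond the last branch to `1`. -/
lemma perronFrobeniusBV_apply_of_map_one {β : ℝ} (hβ : 1 < β) {f : BV} (hf : f 1 = 0)
    {x : unitInterval} (hx : (x : ℝ) < 1) :
    perronFrobeniusBV β hβ f x
      = (1 / (β : ℂ)) * ∑ j ∈ Finset.range (⌊β⌋₊ + 1), f (branch β j x) := by
  classical
  have h0 : 0 < β := by linarith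
  rw [perronFrobeniusBV_apply_sum]
  congr 1
  refine Finset.sum_congr rfl fun j _ => ?_
  by_cases hj : x ∈ branchDom β j
  · rw [indicator_of_mem hj, Function.comp_apply]
  · have h1 : 1 ≤ ((x : ℝ) + j) / β := by
      rw [le_div_iff₀ h0, one_mul]
      by_contra! h
      exact hj ⟨hx, h.le⟩
    have h2 : branch β j x = 1 := projIcc_of_right_le zero_le_one h1
    rw [indicator_of_notMem hj, h2, hf]

lemma perronFrobeniusBV_apply_one {β : ℝ} (hβ : 1 < β) (f : BV) :
    perronFrobeniusBV β hβ f 1 = 0 := by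
  classical
  rw [perronFrobeniusBV_apply_sum, Finset.sum_eq_zero, mul_zero]
  intro j _
  exact indicator_of_notMem (fun h => lt_irrefl _ h.1) _

/-- The total variation, taken with the value `0` at `1`, is contracted by the factor `1/β`:
the inverse branches of `τ_β` map onto non-overlapping intervals, and replacing `ℒ f` by
`ℒ f - (ℒ f)(1-)` makes the jump at `1` vanish. -/
lemma exists_reducedOperator_mk {β : ℝ} (hβ : 1 < β) {f : BV} (hf : f 1 = 0) :
    ∃ g : BV, Submodule.Quotient.mk g = reducedOperator β hβ (Submodule.Quotient.mk f) ∧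
      g 1 = 0 ∧ totalVar g ≤ 1 / β * totalVar f := by
  have h0 : 0 < β := by linarith
  set c : ℂ := leftLimBV (perronFrobeniusBV β hβ f) with hc
  set g : BV := perronFrobeniusBV β hβ f - c • stepBV 1 with hg
  have hgx : ∀ x, g x = perronFrobeniusBV β hβ f x - c * stepBV 1 x := fun _ => rfl
  have hg1 : g 1 = 0 := by
    rw [hgx, perronFrobeniusBV_apply_one, stepBV_apply]
    simp
  refine ⟨g, rfl, hg1, ?_⟩
  have hlim : leftLimBV g = 0 := by
    rw [hg, map_sub, map_smul, leftLimBV_stepBV_one, smul_eq_mul, mul_one, ← hc, sub_self]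
  have hcont : ContinuousWithinAt g (univ ∩ Iic 1) 1 := by
    rw [univ_inter, ← continuousWithinAt_Iio_iff_Iic]
    change Tendsto g (𝓝[<] 1) (𝓝 (g 1))
    rw [hg1, ← hlim]
    exact BV.tendsto_leftLim_one g
  have hIio : eVariationOn g univ = eVariationOn g (Iio 1) := by
    have := eVariationOn.eVariationOn_inter_Iio_eq_inter_Iic_of_continuousWithinAt
      (by rw [univ_inter]; exact nhdsLT_one_neBot) hcont
    rw [univ_inter, univ_inter] at this
    rw [this]
    congr 1
    exact (eq_univ_of_forall fun x => x.2.2).symm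
  have hstep : ∀ x y : unitInterval, x < 1 → y < 1 → edist (g x) (g y) ≤
      ENNReal.ofReal (1 / β) * ∑ j ∈ Finset.range (⌊β⌋₊ + 1),
        edist (f (branch β j x)) (f (branch β j y)) := by
    intro x y hx hy
    have hx' : (x : ℝ) < 1 := hx
    have hy' : (y : ℝ) < 1 := hy
    have hβn : ‖(1 / (β : ℂ))‖ₑ = ENNReal.ofReal (1 / β) := by
      rw [← ofReal_norm, norm_div, norm_one, Complex.norm_real, Real.norm_of_nonneg h0.le]
    have hd : g x - g y = (1 / (β : ℂ)) * ∑ j ∈ Finset.range (⌊β⌋₊ + 1),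
        (f (branch β j x) - f (branch β j y)) := by
      rw [hgx, hgx, perronFrobeniusBV_apply_of_map_one hβ hf hx',
        perronFrobeniusBV_apply_of_map_one hβ hf hy', stepBV_apply, stepBV_apply, if_pos hx',
        if_pos hy', Finset.sum_sub_distrib]
      ring
    rw [edist_eq_enorm_sub, hd, enorm_mul, hβn]
    simp only [edist_eq_enorm_sub]
    gcongr
    exact enorm_sum_le _ _
  have hmain : eVariationOn g univ ≤ ENNReal.ofReal (1 / β) * eVariationOn f univ := by
    rw [hIio]
    refine iSup_le fun ⟨n, u, hu, us⟩ => ?_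
    refine (Finset.sum_le_sum fun i _ => hstep _ _ (us (i + 1)) (us i)).trans ?_
    rw [← Finset.mul_sum, Finset.sum_comm]
    gcongr
    refine le_trans (Finset.sum_le_sum fun j _ => ?_)
      (sum_eVariationOn_comp_branch_le hβ f (⌊β⌋₊ + 1))
    exact eVariationOn.sum_le (f := f ∘ branch β j) hu fun _ => mem_univ _
  have := ENNReal.toReal_mono (ENNReal.mul_ne_top ENNReal.ofReal_ne_top f.2) hmain
  rwa [ENNReal.toReal_mul, ENNReal.toReal_ofReal (by positivity)] at this

lemma exists_reducedOperator_pow_mk {β : ℝ} (hβ : 1 < β) {f : BV} (hf : f 1 = 0) (n : ℕ) :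
    ∃ g : BV, Submodule.Quotient.mk g = (reducedOperator β hβ ^ n) (Submodule.Quotient.mk f) ∧
      g 1 = 0 ∧ totalVar g ≤ (1 / β) ^ n * totalVar f := by
  have h0 : 0 < β := by linarith
  induction n with
  | zero => exact ⟨f, rfl, hf, by simp⟩
  | succ n ih =>
    obtain ⟨g, hg, hg1, hgv⟩ := ih
    obtain ⟨k, hk, hk1, hkv⟩ := exists_reducedOperator_mk hβ hg1
    refine ⟨k, ?_, hk1, hkv.trans ?_⟩
    · rw [hk, hg, pow_succ']
      rfl
    · rw [pow_succ', mul_assoc]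
      gcongr

/-- Each class has a representative vanishing at `1` of comparable variation. -/
lemma exists_mk_eq_map_one_eq_zero (q : BVHat) {ε : ℝ} (hε : 0 < ε) :
    ∃ f : BV, Submodule.Quotient.mk f = q ∧ f 1 = 0 ∧ totalVar f ≤ 3 * (‖q‖ + ε) := by
  obtain ⟨f, hf, hfn⟩ := Submodule.Quotient.norm_mk_lt q hε
  -- `stepBV 2` is the constant function `1`
  set g : BV := f + f 1 • (stepBV 1 + (-1 : ℂ) • stepBV 2) with hg
  have hgx : ∀ x, g x = f x + f 1 * (stepBV 1 x + (-1) * stepBV 2 x) := fun _ => rfl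
  refine ⟨g, ?_, ?_, ?_⟩
  · rw [← hf]
    refine mk_eq_mk_of_eq_off_one fun x hx => ?_
    rw [hgx, stepBV_apply, stepBV_apply, if_pos hx, if_pos (by linarith)]
    ring
  · rw [hgx, stepBV_apply, stepBV_apply]
    norm_num
  · have h1 : totalVar (stepBV 1 + (-1 : ℂ) • stepBV 2) ≤ 2 := by
      refine (totalVar_add_le _ _).trans ?_
      have := totalVar_smul_le (-1) (stepBV 2)
      rw [norm_neg, norm_one, one_mul] at this
      linarith [totalVar_stepBV_le 1, totalVar_stepBV_le 2]
    have h2 := (totalVar_smul_le (f 1) (stepBV 1 + (-1 : ℂ) • stepBV 2)).trans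
      (mul_le_mul_of_nonneg_left h1 (norm_nonneg _))
    have h3 := totalVar_add_le f (f 1 • (stepBV 1 + (-1 : ℂ) • stepBV 2))
    linarith [BV.totalVar_le_norm f, BV.norm_apply_le f 1]

lemma norm_mk_le_two_mul_totalVar {f : BV} (hf : f 1 = 0) :
    ‖(Submodule.Quotient.mk f : BVHat)‖ ≤ 2 * totalVar f := by
  refine (Submodule.Quotient.norm_mk_le nullBV f).trans ?_
  rw [two_mul]
  refine BV.norm_le_of_bounds le_rfl fun x => ?_
  have h : dist (f x) (f 1) ≤ totalVar f :=
    BoundedVariationOn.dist_le f.2 (mem_univ x) (mem_univ 1)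
  rwa [hf, dist_zero_right] at h

lemma norm_reducedOperator_pow_le {β : ℝ} (hβ : 1 < β) (n : ℕ) :
    ‖reducedOperator β hβ ^ n‖ ≤ 6 * (1 / β) ^ n := by
  have h0 : 0 < β := by linarith
  refine ContinuousLinearMap.opNorm_le_bound _ (by positivity) fun q => ?_
  refine le_of_forall_pos_le_add fun ε hε => ?_
  obtain ⟨f, rfl, hf1, hfv⟩ := exists_mk_eq_map_one_eq_zero q
    (show 0 < ε / (6 * (1 / β) ^ n) by positivity)
  obtain ⟨g, hg, hg1, hgv⟩ := exists_reducedOperator_pow_mk hβ hf1 n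
  rw [← hg]
  calc _ ≤ 2 * totalVar g := norm_mk_le_two_mul_totalVar hg1
    _ ≤ 2 * ((1 / β) ^ n * (3 * (‖(Submodule.Quotient.mk f : BVHat)‖
          + ε / (6 * (1 / β) ^ n)))) := by gcongr; exact hgv.trans (by gcongr)
    _ = _ := by field_simp; ring

/-! ### Digits and the functional equation of `F_λ` -/

lemma digit_succ (β : ℝ) (n : ℕ) (x : ℝ) : digit β (n + 1) x = ⌊β * (tau β)^[n] x⌋₊ := rfl

lemma digit_le {β : ℝ} (hβ : 1 < β) {x : ℝ} (hx : x ∈ Icc (0 : ℝ) 1) (n : ℕ) :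
    (digit β (n + 1) x : ℝ) ≤ β := by
  have ht := iterate_tau_mem_Icc β hx n
  rw [digit_succ]
  have : 0 ≤ β * (tau β)^[n] x := mul_nonneg (by linarith) ht.1
  refine (Nat.floor_le this).trans ?_
  nlinarith [ht.2]

lemma norm_term_le {β : ℝ} (hβ : 1 < β) {q : ℂ} {x : ℝ} (hx : x ∈ Icc (0 : ℝ) 1) (n : ℕ) :
    ‖(digit β (n + 1) x : ℂ) / q ^ (n + 1)‖ ≤ β * (‖q‖⁻¹) ^ (n + 1) := by
  rw [norm_div, norm_pow, Complex.norm_natCast, inv_pow, div_eq_mul_inv]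
  gcongr
  exact digit_le hβ hx n

lemma summable_bound {β : ℝ} {q : ℂ} (hq : 1 < ‖q‖) :
    Summable fun n : ℕ => β * (‖q‖⁻¹) ^ (n + 1) :=
  ((summable_nat_add_iff 1).2
    (summable_geometric_of_lt_one (by positivity) (inv_lt_one_of_one_lt₀ hq))).mul_left β

lemma summable_term {β : ℝ} (hβ : 1 < β) {q : ℂ} (hq : 1 < ‖q‖) {x : ℝ}
    (hx : x ∈ Icc (0 : ℝ) 1) :
    Summable fun n : ℕ => (digit β (n + 1) x : ℂ) / q ^ (n + 1) :=
  Summable.of_norm_bounded (summable_bound hq) (norm_term_le hβ hx)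

lemma exists_norm_F_le {β : ℝ} (hβ : 1 < β) {lam : ℂ} (hq : 1 < ‖(β : ℂ) * lam‖) :
    ∃ M, 0 ≤ M ∧ ∀ x ∈ Icc (0 : ℝ) 1, ‖F β lam x‖ ≤ M := by
  refine ⟨∑' n : ℕ, β * (‖(β : ℂ) * lam‖⁻¹) ^ (n + 1),
    tsum_nonneg fun n => by have : 0 < β := by linarith
                            positivity, fun x hx => ?_⟩
  exact tsum_of_norm_bounded (summable_bound hq).hasSum (norm_term_le hβ hx)

lemma one_lt_norm_mul {β : ℝ} (hβ : 1 < β) {lam : ℂ} (hlam : 1 / β < ‖lam‖) :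
    1 < ‖(β : ℂ) * lam‖ := by
  have h0 : 0 < β := by linarith
  rwa [norm_mul, Complex.norm_real, Real.norm_of_nonneg h0.le, ← div_lt_iff₀' h0]

lemma F_eq_digit_add {β : ℝ} (hβ : 1 < β) {lam : ℂ} (hq : 1 < ‖(β : ℂ) * lam‖) {x : ℝ}
    (hx : x ∈ Icc (0 : ℝ) 1) :
    F β lam x = ((digit β 1 x : ℂ) + F β lam (tau β x)) / ((β : ℂ) * lam) := by
  rw [F, (summable_term hβ hq hx).tsum_eq_zero_add, add_div, F, ← tsum_div_const]
  congr 1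
  · simp
  · refine tsum_congr fun n => ?_
    rw [div_div, ← pow_succ]
    rfl

lemma F_zero (β : ℝ) (lam : ℂ) : F β lam 0 = 0 := by
  have h : ∀ n, (tau β)^[n] 0 = 0 := fun n => Function.iterate_fixed (by simp [tau]) n
  simp [F, digit_succ, h]

/-- If the first `n` digits of `x` and `y` agree, the increment of `F_λ` is that of the `n`-th
iterates, divided by `(βλ)^n`. -/
lemma F_sub_F_of_prefix {β : ℝ} (hβ : 1 < β) {lam : ℂ} (hq : 1 < ‖(β : ℂ) * lam‖) {x y : ℝ}
    (hx : x ∈ Icc (0 : ℝ) 1) (hy : y ∈ Icc (0 : ℝ) 1) {n : ℕ}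
    (h : ∀ k < n, digit β (k + 1) y = digit β (k + 1) x) :
    F β lam y - F β lam x
      = (F β lam ((tau β)^[n] y) - F β lam ((tau β)^[n] x)) / ((β : ℂ) * lam) ^ n := by
  induction n with
  | zero => simp
  | succ n ih =>
    have hd : digit β 1 ((tau β)^[n] y) = digit β 1 ((tau β)^[n] x) := h n n.lt_succ_self
    rw [ih fun k hk => h k (hk.trans n.lt_succ_self),
      F_eq_digit_add hβ hq (iterate_tau_mem_Icc β hx n),
      F_eq_digit_add hβ hq (iterate_tau_mem_Icc β hy n), hd, Function.iterate_succ_apply',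
      Function.iterate_succ_apply', pow_succ]
    have : (β : ℂ) * lam ≠ 0 := norm_pos_iff.1 (by linarith)
    field_simp
    ring

lemma eventually_prefix {β x : ℝ} {l : Filter ℝ} {n : ℕ}
    (h : ∀ k < n, ∀ᶠ y in l, ⌊β * ((tau β)^[k] x + β ^ k * (y - x))⌋ = ⌊β * (tau β)^[k] x⌋) :
    ∀ᶠ y in l, (∀ k < n, digit β (k + 1) y = digit β (k + 1) x) ∧
      (tau β)^[n] y = (tau β)^[n] x + β ^ n * (y - x) := by
  induction n with
  | zero => exact Eventually.of_forall fun y => ⟨by simp, by simp⟩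
  | succ n ih =>
    filter_upwards [ih fun k hk => h k (hk.trans n.lt_succ_self), h n n.lt_succ_self]
      with y hy hfl
    refine ⟨fun k hk => ?_, ?_⟩
    · rcases Nat.lt_succ_iff_lt_or_eq.1 hk with hk' | rfl
      · exact hy.1 k hk'
      · rw [digit_succ, digit_succ, hy.2, ← Int.floor_toNat, ← Int.floor_toNat, hfl]
    · rw [Function.iterate_succ_apply', Function.iterate_succ_apply', hy.2, tau, tau, Int.fract,
        Int.fract, hfl]
      ring

lemma eventually_prefix_nhdsGE {β : ℝ} (hβ : 1 < β) (x : ℝ) (n : ℕ) :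
    ∀ᶠ y in 𝓝[≥] x, (∀ k < n, digit β (k + 1) y = digit β (k + 1) x) ∧
      (tau β)^[n] y = (tau β)^[n] x + β ^ n * (y - x) := by
  refine eventually_prefix fun k _ => ?_
  have h0 : 0 < β := by linarith
  have hc : Tendsto (fun y => β * ((tau β)^[k] x + β ^ k * (y - x))) (𝓝[≥] x)
      (𝓝[≥] (β * (tau β)^[k] x)) := by
    refine tendsto_nhdsWithin_iff.2 ⟨?_, ?_⟩
    · have : Continuous fun y => β * ((tau β)^[k] x + β ^ k * (y - x)) := by fun_prop
      have := this.tendsto x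
      simp only [sub_self, mul_zero, add_zero] at this
      exact this.mono_left nhdsWithin_le_nhds
    · filter_upwards [self_mem_nhdsWithin] with y hy
      have hy' : 0 ≤ y - x := sub_nonneg.2 hy
      have : 0 ≤ β ^ k * (y - x) := by positivity
      exact mul_le_mul_of_nonneg_left (by linarith) h0.le
  exact hc.eventually (tendsto_pure.1 (tendsto_floor_right_pure_floor _))

lemma eventually_prefix_nhds {β : ℝ} {x : ℝ} {n : ℕ}
    (h : ∀ k < n, (tau β)^[k + 1] x ≠ 0) :
    ∀ᶠ y in 𝓝 x, (∀ k < n, digit β (k + 1) y = digit β (k + 1) x) ∧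
      (tau β)^[n] y = (tau β)^[n] x + β ^ n * (y - x) := by
  refine eventually_prefix fun k hk => ?_
  have hfr : Int.fract (β * (tau β)^[k] x) ≠ 0 := by
    have := h k hk
    rwa [Function.iterate_succ_apply'] at this
  have hpos : 0 < Int.fract (β * (tau β)^[k] x) := lt_of_le_of_ne (Int.fract_nonneg _) hfr.symm
  have hmem : ∀ᶠ s in 𝓝 (β * (tau β)^[k] x), ⌊s⌋ = ⌊β * (tau β)^[k] x⌋ := by
    have h1 : (⌊β * (tau β)^[k] x⌋ : ℝ) < β * (tau β)^[k] x := by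
      rw [Int.fract] at hpos
      linarith
    filter_upwards [Ioo_mem_nhds h1 (Int.lt_floor_add_one _)] with s hs
    exact Int.floor_eq_iff.2 ⟨hs.1.le, hs.2⟩
  have hc : Tendsto (fun y => β * ((tau β)^[k] x + β ^ k * (y - x))) (𝓝 x)
      (𝓝 (β * (tau β)^[k] x)) := by
    have : Continuous fun y => β * ((tau β)^[k] x + β ^ k * (y - x)) := by fun_prop
    have := this.tendsto x
    simpa only [sub_self, mul_zero, add_zero] using this
  exact hc.eventually hmem

/-- `F_λ` is continuous along any filter along which each digit is eventually constant. -/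
lemma tendsto_F_of_eventually_prefix {β : ℝ} (hβ : 1 < β) {lam : ℂ}
    (hq : 1 < ‖(β : ℂ) * lam‖) {x : ℝ} (hx : x ∈ Icc (0 : ℝ) 1) {l : Filter ℝ}
    (hl : ∀ᶠ y in l, y ∈ Icc (0 : ℝ) 1)
    (h : ∀ n : ℕ, ∀ᶠ y in l, ∀ k < n, digit β (k + 1) y = digit β (k + 1) x) :
    Tendsto (F β lam) l (𝓝 (F β lam x)) := by
  obtain ⟨M, hM0, hM⟩ := exists_norm_F_le hβ hq
  rw [Metric.tendsto_nhds]
  intro ε hε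
  have hlim : Tendsto (fun n : ℕ => (M + M) * (‖(β : ℂ) * lam‖⁻¹) ^ n) atTop (𝓝 ((M + M) * 0)) :=
    (tendsto_pow_atTop_nhds_zero_of_lt_one (by positivity)
      (inv_lt_one_of_one_lt₀ hq)).const_mul _
  rw [mul_zero] at hlim
  obtain ⟨n, hn⟩ := (hlim.eventually_lt_const hε).exists
  filter_upwards [hl, h n] with y hy hyn
  rw [dist_eq_norm, F_sub_F_of_prefix hβ hq hx hy hyn, norm_div, norm_pow, div_eq_mul_inv,
    ← inv_pow]
  refine lt_of_le_of_lt ?_ hn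
  gcongr
  exact (norm_sub_le _ _).trans (add_le_add (hM _ (iterate_tau_mem_Icc β hy n))
    (hM _ (iterate_tau_mem_Icc β hx n)))

lemma continuousWithinAt_F_right {β : ℝ} (hβ : 1 < β) {lam : ℂ}
    (hq : 1 < ‖(β : ℂ) * lam‖) {x : ℝ} (hx : x ∈ Icc (0 : ℝ) 1) :
    ContinuousWithinAt (F β lam) (Icc x 1) x := by
  refine tendsto_F_of_eventually_prefix hβ hq hx ?_ fun n => ?_
  · filter_upwards [self_mem_nhdsWithin] with y hy using ⟨hx.1.trans hy.1, hy.2⟩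
  · filter_upwards [nhdsWithin_mono x Icc_subset_Ici_self (eventually_prefix_nhdsGE hβ x n)]
      with y hy using hy.1

lemma continuousWithinAt_F_left_of_ne {β : ℝ} (hβ : 1 < β) {lam : ℂ}
    (hq : 1 < ‖(β : ℂ) * lam‖) {x : ℝ} (hx : x ∈ Icc (0 : ℝ) 1)
    (h : ∀ k, (tau β)^[k + 1] x ≠ 0) :
    ContinuousWithinAt (F β lam) (Icc 0 x) x := by
  refine tendsto_F_of_eventually_prefix hβ hq hx ?_ fun n => ?_
  · filter_upwards [self_mem_nhdsWithin] with y hy using ⟨hy.1, hy.2.trans hx.2⟩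
  · filter_upwards [nhdsWithin_le_nhds (eventually_prefix_nhds (n := n) fun k _ => h k)]
      with y hy using hy.1

/-! ### Simple points -/

/-- The orbit of `x` under `τ_β` reaches `0` for the first time after `N + 1` steps, `N ≥ 0`. -/
def HitsZeroAfter (β x : ℝ) (N : ℕ) : Prop :=
  (∀ k ≤ N, (tau β)^[k] x ≠ 0) ∧ (tau β)^[N + 1] x = 0

lemma exists_hitsZeroAfter {β x : ℝ} (hx : x ≠ 0) {n : ℕ} (hn : (tau β)^[n] x = 0) :
    ∃ N, HitsZeroAfter β x N := by
  classical
  have hex : ∃ n, (tau β)^[n] x = 0 := ⟨n, hn⟩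
  have hpos : Nat.find hex ≠ 0 := fun h0 => hx (by simpa [h0] using Nat.find_spec hex)
  obtain ⟨N, hN⟩ := Nat.exists_eq_succ_of_ne_zero hpos
  refine ⟨N, fun k hk => Nat.find_min hex (by omega), ?_⟩
  have := Nat.find_spec hex
  rwa [hN] at this

lemma HitsZeroAfter.exists_mul_eq {β x : ℝ} (hβ : 1 < β) (hx : x ∈ Icc (0 : ℝ) 1) {N : ℕ}
    (h : HitsZeroAfter β x N) :
    ∃ j : ℕ, β * (tau β)^[N] x = (j + 1 : ℕ) ∧ j + 1 ≤ ⌊β⌋₊ := by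
  have h0 : 0 < β := by linarith
  have ht := iterate_tau_mem_Icc β hx N
  have hpos : 0 < β * (tau β)^[N] x := mul_pos h0 (lt_of_le_of_ne ht.1 (h.1 N le_rfl).symm)
  have h1 := h.2
  rw [Function.iterate_succ_apply', tau, Int.fract, sub_eq_zero,
    ← natCast_floor_eq_intCast_floor hpos.le] at h1
  have hne : ⌊β * (tau β)^[N] x⌋₊ ≠ 0 := fun h2 => by
    rw [h2, Nat.cast_zero] at h1
    exact hpos.ne' h1
  obtain ⟨j, hj⟩ := Nat.exists_eq_succ_of_ne_zero hne
  rw [hj] at h1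
  refine ⟨j, h1, ?_⟩
  rw [← Nat.succ_eq_add_one, ← hj]
  exact Nat.floor_mono (by nlinarith [ht.2])

lemma isSimplePoint_iff {β x : ℝ} (hβ : 1 < β) (hx : x ∈ Ioc (0 : ℝ) 1) :
    IsSimplePoint β x ↔ ∃ N, HitsZeroAfter β x N := by
  have h0 : 0 < β := by linarith
  constructor
  · rintro ⟨m, j, hj, h⟩
    refine exists_hitsZeroAfter (n := m + 1) hx.1.ne' ?_
    rw [Function.iterate_succ_apply', h, tau, mul_div_cancel₀ _ h0.ne', Int.fract_natCast]
  · rintro ⟨N, hN⟩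
    obtain ⟨j, hj, hjβ⟩ := hN.exists_mul_eq hβ ⟨hx.1.le, hx.2⟩
    exact ⟨N, j + 1, Finset.mem_Icc.2 ⟨by omega, hjβ⟩,
      (eq_div_iff h0.ne').2 (by rw [← hj, mul_comm])⟩

lemma iterate_ne_zero_of_not_isSimplePoint {β x : ℝ} (hβ : 1 < β) (hx : x ∈ Ioc (0 : ℝ) 1)
    (h : ¬ IsSimplePoint β x) (k : ℕ) : (tau β)^[k + 1] x ≠ 0 := fun hk =>
  h ((isSimplePoint_iff hβ hx).2 (exists_hitsZeroAfter hx.1.ne' hk))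

/-- To the left of a simple point `x`, the last nonzero digit of `x` drops by one and the orbit
continues near `1` instead of `0`. -/
lemma HitsZeroAfter.eventually_F_sub {β : ℝ} (hβ : 1 < β) {lam : ℂ}
    (hq : 1 < ‖(β : ℂ) * lam‖) {x : ℝ} (hx : x ∈ Ioc (0 : ℝ) 1) {N : ℕ}
    (h : HitsZeroAfter β x N) :
    ∀ᶠ y in 𝓝[<] x, F β lam y - F β lam x
      = (F β lam (1 - β ^ (N + 1) * (x - y)) - 1) / ((β : ℂ) * lam) ^ (N + 1) := by
  have h0 : 0 < β := by linarith
  have hx' : x ∈ Icc (0 : ℝ) 1 := ⟨hx.1.le, hx.2⟩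
  obtain ⟨j, hj, -⟩ := h.exists_mul_eq hβ hx'
  have hsmall : ∀ᶠ y in 𝓝[<] x, β ^ (N + 1) * (x - y) < 1 := by
    have : Continuous fun y : ℝ => β ^ (N + 1) * (x - y) := by fun_prop
    have := this.tendsto x
    simp only [sub_self, mul_zero] at this
    exact nhdsWithin_le_nhds (this.eventually_lt_const one_pos)
  filter_upwards [self_mem_nhdsWithin, hsmall, nhdsWithin_le_nhds (lt_mem_nhds hx.1),
    nhdsWithin_le_nhds (eventually_prefix_nhds (n := N) fun k hk => h.1 (k + 1) hk)]
    with y hyx hys hy0 hyp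
  have hyx' : 0 < x - y := sub_pos.2 hyx
  have hy : y ∈ Icc (0 : ℝ) 1 := ⟨le_of_lt hy0, (le_of_lt hyx).trans hx.2⟩
  have hs : β * (tau β)^[N] y = j + (1 - β ^ (N + 1) * (x - y)) := by
    rw [hyp.2, mul_add, hj]
    push_cast
    ring
  have hpos : 0 < β ^ (N + 1) * (x - y) := by positivity
  have hdy : digit β 1 ((tau β)^[N] y) = j := by
    change ⌊β * (tau β)^[N] y⌋₊ = j
    rw [hs, Nat.floor_eq_iff (by positivity)]
    constructor <;> linarith
  have hty : tau β ((tau β)^[N] y) = 1 - β ^ (N + 1) * (x - y) := by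
    rw [tau, hs, Int.fract_natCast_add, Int.fract_eq_self]
    constructor <;> linarith
  have hdx : digit β 1 ((tau β)^[N] x) = j + 1 := by
    change ⌊β * (tau β)^[N] x⌋₊ = j + 1
    rw [hj, Nat.floor_natCast]
  have htx : tau β ((tau β)^[N] x) = 0 := by rw [tau, hj, Int.fract_natCast]
  rw [F_sub_F_of_prefix hβ hq hx' hy hyp.1, F_eq_digit_add hβ hq (iterate_tau_mem_Icc β hx' N),
    F_eq_digit_add hβ hq (iterate_tau_mem_Icc β hy N), hdy, hty, hdx, htx, F_zero,
    pow_succ ((β : ℂ) * lam)]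
  have hne : (β : ℂ) * lam ≠ 0 := norm_pos_iff.1 (by linarith)
  generalize F β lam (1 - β ^ (N + 1) * (x - y)) = A
  generalize (β : ℂ) * lam = q at hne ⊢
  push_cast
  field_simp
  ring

lemma continuousWithinAt_Icc_left_iff {f : ℝ → ℂ} {x : ℝ} (hx : 0 < x) :
    ContinuousWithinAt f (Icc 0 x) x ↔ Tendsto f (𝓝[<] x) (𝓝 (f x)) := by
  rw [ContinuousWithinAt, nhdsWithin_Icc_eq_nhdsLE hx]
  exact (continuousWithinAt_Iio_iff_Iic (f := f) (a := x)).symm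

/-- An affine map of positive slope carries left neighbourhoods to left neighbourhoods. -/
lemma tendsto_affine_nhdsLT {a b c : ℝ} (hc : 0 < c) :
    Tendsto (fun y => b - c * (a - y)) (𝓝[<] a) (𝓝[<] b) := by
  refine tendsto_nhdsWithin_iff.2 ⟨?_, ?_⟩
  · have : Continuous fun y => b - c * (a - y) := by fun_prop
    have := this.tendsto a
    simp only [sub_self, mul_zero, sub_zero] at this
    exact this.mono_left nhdsWithin_le_nhds
  · filter_upwards [self_mem_nhdsWithin] with y hy
    have : 0 < c * (a - y) := mul_pos hc (sub_pos.2 hy)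
    exact sub_lt_self b this

lemma HitsZeroAfter.continuousWithinAt_iff {β : ℝ} (hβ : 1 < β) {lam : ℂ}
    (hq : 1 < ‖(β : ℂ) * lam‖) {x : ℝ} (hx : x ∈ Ioc (0 : ℝ) 1) {N : ℕ}
    (h : HitsZeroAfter β x N) :
    ContinuousWithinAt (F β lam) (Icc 0 x) x ↔ Tendsto (F β lam) (𝓝[<] 1) (𝓝 1) := by
  have h0 : 0 < β := by linarith
  have hne : ((β : ℂ) * lam) ^ (N + 1) ≠ 0 := pow_ne_zero _ (norm_pos_iff.1 (by linarith))
  rw [continuousWithinAt_Icc_left_iff hx.1]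
  have hev := h.eventually_F_sub hβ hq hx
  constructor
  · intro hF
    have hmap := tendsto_affine_nhdsLT (a := 1) (b := x) (c := (β ^ (N + 1))⁻¹) (by positivity)
    have h1 : Tendsto (fun z => (F β lam (x - (β ^ (N + 1))⁻¹ * (1 - z)) - F β lam x)
        * ((β : ℂ) * lam) ^ (N + 1) + 1) (𝓝[<] 1) (𝓝 ((F β lam x - F β lam x)
        * ((β : ℂ) * lam) ^ (N + 1) + 1)) :=
      (((hF.comp hmap).sub_const _).mul_const _).add_const _
    rw [sub_self, zero_mul, zero_add] at h1
    refine h1.congr' ?_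
    filter_upwards [hmap.eventually hev] with z hz
    have e : 1 - β ^ (N + 1) * (x - (x - (β ^ (N + 1))⁻¹ * (1 - z))) = z := by
      field_simp
      ring
    rw [hz, e, div_mul_cancel₀ _ hne, sub_add_cancel]
  · intro hF
    have hmap := tendsto_affine_nhdsLT (a := x) (b := 1) (c := β ^ (N + 1)) (by positivity)
    have h1 : Tendsto (fun y => (F β lam (1 - β ^ (N + 1) * (x - y)) - 1)
        / ((β : ℂ) * lam) ^ (N + 1) + F β lam x) (𝓝[<] x) (𝓝 ((1 - 1)
        / ((β : ℂ) * lam) ^ (N + 1) + F β lam x)) :=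
      (((hF.comp hmap).sub_const _).div_const _).add_const _
    rw [sub_self, zero_div, zero_add] at h1
    refine h1.congr' ?_
    filter_upwards [hev] with y hy
    rw [← hy, sub_add_cancel]

lemma tendsto_F_one_left_iff {β : ℝ} (hβ : 1 < β) {lam : ℂ} (hq : 1 < ‖(β : ℂ) * lam‖) :
    Tendsto (F β lam) (𝓝[<] 1) (𝓝 1) ↔ F β lam 1 = 1 := by
  have h0 : 0 < β := by linarith
  have h1 : (1 : ℝ) ∈ Ioc (0 : ℝ) 1 := ⟨one_pos, le_rfl⟩
  by_cases hs : IsSimplePoint β 1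
  · obtain ⟨N, hN⟩ := (isSimplePoint_iff hβ h1).1 hs
    constructor
    · intro hF
      exact tendsto_nhds_unique
        ((continuousWithinAt_Icc_left_iff one_pos).1 ((hN.continuousWithinAt_iff hβ hq h1).2 hF)) hF
    · intro hF1
      have hev := hN.eventually_F_sub hβ hq h1
      rw [hF1] at hev
      have hmap := tendsto_affine_nhdsLT (a := 1) (b := 1) (c := β ^ (N + 1)) (by positivity)
      obtain ⟨M, hM0, hM⟩ := exists_norm_F_le hβ hq
      -- self-similarity at `1` contracts the oscillation of `F_λ` by a fixed factor
      have hk : ∀ k : ℕ, ∀ᶠ y in 𝓝[<] (1 : ℝ),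
          ‖F β lam y - 1‖ ≤ (M + 1) * ((‖(β : ℂ) * lam‖ ^ (N + 1))⁻¹) ^ k := by
        intro k
        induction k with
        | zero =>
          filter_upwards [Ioo_mem_nhdsLT (zero_lt_one' ℝ)] with y hy
          rw [pow_zero, mul_one]
          refine (norm_sub_le _ _).trans ?_
          rw [norm_one]
          linarith [hM y ⟨hy.1.le, hy.2.le⟩]
        | succ k ih =>
          filter_upwards [hev, hmap.eventually ih] with y hy hy'
          rw [hy, norm_div, norm_pow, div_eq_mul_inv,
            pow_succ (‖(β : ℂ) * lam‖ ^ (N + 1))⁻¹, ← mul_assoc]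
          gcongr
      have hlt : (‖(β : ℂ) * lam‖ ^ (N + 1))⁻¹ < 1 :=
        inv_lt_one_of_one_lt₀ (one_lt_pow₀ hq (Nat.succ_ne_zero N))
      have hlim : Tendsto (fun k : ℕ => (M + 1) * ((‖(β : ℂ) * lam‖ ^ (N + 1))⁻¹) ^ k) atTop
          (𝓝 ((M + 1) * 0)) :=
        (tendsto_pow_atTop_nhds_zero_of_lt_one (by positivity) hlt).const_mul _
      rw [mul_zero] at hlim
      rw [Metric.tendsto_nhds]
      intro ε hε
      obtain ⟨k, hkε⟩ := (hlim.eventually_lt_const hε).exists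
      filter_upwards [hk k] with y hy
      rw [dist_eq_norm]
      exact hy.trans_lt hkε
  · have hc := continuousWithinAt_F_left_of_ne hβ hq ⟨zero_le_one, le_rfl⟩
      (iterate_ne_zero_of_not_isSimplePoint hβ h1 hs)
    rw [continuousWithinAt_Icc_left_iff one_pos] at hc
    exact ⟨fun hF => tendsto_nhds_unique hc hF, fun hF => hF ▸ hc⟩

/-! ### The spectrum of the Perron-Frobenius operator -/

/-- Outside the disc of radius `1/β` the reduced operator has a resolvent, and expanding it in its
Neumann series along the orbit of `1` identifies `F_z(1)` with `φ((z - S)⁻¹ 1)`, where `φ` is the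
boundary functional. -/
lemma exists_resolvent_stepBV {β : ℝ} (hβ : 1 < β) {z : ℂ} (hz : 1 / β < ‖z‖) :
    IsUnit (algebraMap ℂ (BVHat →L[ℂ] BVHat) z - reducedOperator β hβ) ∧
    ∃ v : BVHat, z • v - reducedOperator β hβ v = Submodule.Quotient.mk (stepBV 1) ∧
      boundaryFunctional β hβ v = F β z 1 := by
  have h0 : 0 < β := by linarith
  have hβ0 : (β : ℂ) ≠ 0 := Complex.ofReal_ne_zero.2 h0.ne'
  have hz0 : z ≠ 0 := norm_pos_iff.1 ((by positivity : (0 : ℝ) < 1 / β).trans hz)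
  set S := reducedOperator β hβ with hS
  have hsum := summable_inv_smul_pow (norm_reducedOperator_pow_le hβ) (by positivity) hz
  set Q : BVHat →L[ℂ] BVHat := ∑' n : ℕ, (z⁻¹ • S) ^ n with hQ
  have hQ1 : (1 - z⁻¹ • S) * Q = 1 := hsum.one_sub_mul_tsum_pow
  have hQ2 : Q * (1 - z⁻¹ • S) = 1 := hsum.tsum_pow_mul_one_sub
  have hfac : algebraMap ℂ (BVHat →L[ℂ] BVHat) z - S
      = algebraMap ℂ (BVHat →L[ℂ] BVHat) z * (1 - z⁻¹ • S) := by
    rw [mul_sub, mul_one, ← Algebra.smul_def, smul_inv_smul₀ hz0]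
  set u : BVHat := Submodule.Quotient.mk (stepBV 1) with hu
  refine ⟨?_, z⁻¹ • Q u, ?_, ?_⟩
  · rw [hfac]
    exact ((IsUnit.mk0 z hz0).map (algebraMap ℂ (BVHat →L[ℂ] BVHat))).mul ⟨⟨_, Q, hQ1, hQ2⟩, rfl⟩
  · have h1 : Q u - z⁻¹ • S (Q u) = u := congrArg (fun T : BVHat →L[ℂ] BVHat => T u) hQ1
    rw [smul_inv_smul₀ hz0, map_smul, h1]
  · have hsu : HasSum (fun n : ℕ => boundaryFunctional β hβ (((z⁻¹ • S) ^ n) u))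
        (boundaryFunctional β hβ (Q u)) :=
      (boundaryFunctional β hβ).hasSum
        ((ContinuousLinearMap.apply ℂ BVHat u).hasSum hsum.hasSum)
    rw [map_smul, smul_eq_mul, ← hsu.tsum_eq, ← tsum_mul_left, F]
    refine tsum_congr fun n => ?_
    have h1 : ((1 : ℝ)) ∈ Icc (0 : ℝ) 1 := ⟨zero_le_one, le_rfl⟩
    rw [smul_pow_apply, hS, hu, reducedOperator_pow_stepBV hβ h1, map_smul,
      map_smul, boundaryFunctional_stepBV hβ (iterate_tau_mem_Icc β h1 n), digit_succ, smul_eq_mul,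
      smul_eq_mul, pow_succ, mul_pow, one_div, inv_pow, inv_pow]
    field_simp

lemma notMem_spectrum_of_F_one_ne {β : ℝ} (hβ : 1 < β) {z : ℂ} (hz : 1 / β < ‖z‖)
    (h : F β z 1 ≠ 1) : z ∉ spectrum ℂ (perronFrobenius β hβ) := by
  obtain ⟨hS, v, hv, hφ⟩ := exists_resolvent_stepBV hβ hz
  rw [← reducedOperator_add_smulRight]
  exact notMem_spectrum_add_smulRight _ _ hS hv (by rwa [hφ])

lemma hasEigenvalue_of_F_one_eq {β : ℝ} (hβ : 1 < β) {z : ℂ} (hz : 1 / β < ‖z‖)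
    (h : F β z 1 = 1) :
    Module.End.HasEigenvalue (perronFrobenius β hβ : Module.End ℂ BVHat) z := by
  obtain ⟨hS, v, hv, hφ⟩ := exists_resolvent_stepBV hβ hz
  rw [← reducedOperator_add_smulRight]
  exact hasEigenvalue_add_smulRight _ _ hv (by rw [hφ, h])

/-- In the variable `w = 1/(βz)`, `F_z(1)` is a power series without constant term, so the solutions
of `F_z(1) = 1` are isolated. -/
lemma eventually_F_one_ne {β : ℝ} (hβ : 1 < β) {lam : ℂ} (hlam : 1 / β < ‖lam‖) :
    ∀ᶠ z in 𝓝[≠] lam, F β z 1 ≠ 1 := by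
  have h0 : 0 < β := by linarith
  have hβ0 : (β : ℂ) ≠ 0 := Complex.ofReal_ne_zero.2 h0.ne'
  have hlam0 : lam ≠ 0 := norm_pos_iff.1 ((by positivity : (0 : ℝ) < 1 / β).trans hlam)
  have h1 : ((1 : ℝ)) ∈ Icc (0 : ℝ) 1 := ⟨zero_le_one, le_rfl⟩
  set w₀ : ℂ := ((β : ℂ) * lam)⁻¹ with hw₀
  have hw₀1 : ‖w₀‖ < 1 := by
    rw [hw₀, norm_inv]
    exact inv_lt_one_of_one_lt₀ (one_lt_norm_mul hβ hlam)
  obtain ⟨r, hr, hr1⟩ := exists_between hw₀1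
  have hr0 : 0 < r := (norm_nonneg _).trans_lt hr
  set G : ℂ → ℂ := fun w => ∑' n : ℕ, (digit β (n + 1) 1 : ℂ) * w ^ (n + 1) with hG
  have hFG : ∀ z, F β z 1 = G ((β : ℂ) * z)⁻¹ := fun z =>
    tsum_congr fun n => by rw [div_eq_mul_inv, inv_pow]
  have hdiff : DifferentiableOn ℂ G (Metric.ball 0 r) := by
    refine Complex.differentiableOn_tsum_of_summable_norm (u := fun n => β * r ^ (n + 1)) ?_
      (fun n => by fun_prop) Metric.isOpen_ball fun n w hw => ?_
    · exact ((summable_nat_add_iff 1).2 (summable_geometric_of_lt_one hr0.le hr1)).mul_left β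
    · rw [norm_mul, norm_pow, Complex.norm_natCast]
      rw [mem_ball_zero_iff] at hw
      gcongr
      exact digit_le hβ h1 n
  have hG0 : G 0 = 0 := by simp [hG]
  have hGne : ∀ᶠ w in 𝓝[≠] w₀, G w ≠ 1 := by
    by_contra hcon
    have hfreq : ∃ᶠ w in 𝓝[≠] w₀, G w = (fun _ => (1 : ℂ)) w := by
      simpa only [not_eventually, not_not] using hcon
    have := (hdiff.analyticOnNhd Metric.isOpen_ball).eqOn_of_preconnected_of_frequently_eq
      analyticOnNhd_const (convex_ball (0 : ℂ) r).isPreconnected (mem_ball_zero_iff.2 hr) hfreq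
      (Metric.mem_ball_self hr0)
    rw [hG0] at this
    exact zero_ne_one this
  have hmap : Tendsto (fun z : ℂ => ((β : ℂ) * z)⁻¹) (𝓝[≠] lam) (𝓝[≠] w₀) := by
    refine tendsto_nhdsWithin_iff.2 ⟨?_, ?_⟩
    · exact ((continuous_const.mul continuous_id).tendsto lam).inv₀ (mul_ne_zero hβ0 hlam0)
        |>.mono_left nhdsWithin_le_nhds
    · filter_upwards [self_mem_nhdsWithin] with z hz h
      exact hz (mul_left_cancel₀ hβ0 (inv_injective h))
  filter_upwards [hmap.eventually hGne] with z hz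
  rwa [hFG]

lemma isIsolatedEigenvalue_iff {β : ℝ} (hβ : 1 < β) {lam : ℂ} (hlam : 1 / β < ‖lam‖) :
    IsIsolatedEigenvalue (perronFrobenius β hβ) lam ↔ F β lam 1 = 1 := by
  constructor
  · rintro ⟨h, -⟩
    by_contra hne
    exact notMem_spectrum_of_F_one_ne hβ hlam hne (mem_spectrum_of_hasEigenvalue h)
  · intro h
    refine ⟨hasEigenvalue_of_F_one_eq hβ hlam h, ?_⟩
    filter_upwards [eventually_F_one_ne hβ hlam, nhdsWithin_le_nhds
      (continuous_norm.continuousAt.eventually_const_lt hlam)] with z hz hzn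
    exact notMem_spectrum_of_F_one_ne hβ hzn hz

/-! ### The leading eigenvalue -/

/-- The greedy expansion converges to `x`: the error `F_1(x) - x` is bounded and is divided by `β`
along each step of the orbit. -/
lemma F_one_eq_self {β : ℝ} (hβ : 1 < β) {x : ℝ} (hx : x ∈ Icc (0 : ℝ) 1) :
    F β 1 x = (x : ℂ) := by
  have h0 : 0 < β := by linarith
  have hβ0 : (β : ℂ) ≠ 0 := Complex.ofReal_ne_zero.2 h0.ne'
  have hq : 1 < ‖(β : ℂ) * 1‖ := by
    rw [mul_one, Complex.norm_real, Real.norm_of_nonneg h0.le]; exact hβ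
  obtain ⟨M, hM0, hM⟩ := exists_norm_F_le hβ hq
  have hstep : ∀ y ∈ Icc (0 : ℝ) 1, F β 1 y - y = (F β 1 (tau β y) - tau β y) / β := by
    intro y hy
    have hfl : (digit β 1 y : ℝ) + tau β y = β * y := by
      change (⌊β * y⌋₊ : ℝ) + _ = _
      rw [tau, natCast_floor_eq_intCast_floor (mul_nonneg h0.le hy.1), Int.floor_add_fract]
    have hfl' : (digit β 1 y : ℂ) + tau β y = β * y := by exact_mod_cast hfl
    rw [F_eq_digit_add hβ hq hy, mul_one, eq_sub_of_add_eq hfl']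
    field_simp
    ring
  have hiter : ∀ n : ℕ, F β 1 x - x
      = (F β 1 ((tau β)^[n] x) - ((tau β)^[n] x : ℝ)) / (β : ℂ) ^ n := by
    intro n
    induction n with
    | zero => simp
    | succ n ih =>
      rw [ih, hstep _ (iterate_tau_mem_Icc β hx n), Function.iterate_succ_apply', div_div,
        pow_succ']
  have hbound : ∀ n : ℕ, ‖F β 1 x - x‖ ≤ (M + 1) * β⁻¹ ^ n := by
    intro n
    have ht := iterate_tau_mem_Icc β hx n
    rw [hiter n, norm_div, norm_pow, Complex.norm_real, Real.norm_of_nonneg h0.le,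
      div_eq_mul_inv, inv_pow]
    gcongr
    refine (norm_sub_le _ _).trans (add_le_add (hM _ ht) ?_)
    rw [Complex.norm_real, Real.norm_of_nonneg ht.1]
    exact ht.2
  have hlim : Tendsto (fun n : ℕ => (M + 1) * β⁻¹ ^ n) atTop (𝓝 ((M + 1) * 0)) :=
    (tendsto_pow_atTop_nhds_zero_of_lt_one (by positivity) (inv_lt_one_of_one_lt₀ hβ)).const_mul _
  rw [mul_zero] at hlim
  exact sub_eq_zero.1 (norm_le_zero_iff.1 (ge_of_tendsto' hlim hbound))

lemma digit_one_pos {β : ℝ} (hβ : 1 < β) : 1 ≤ digit β 1 1 := by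
  change 1 ≤ ⌊β * 1⌋₊
  rw [mul_one]
  exact Nat.le_floor (by simpa using hβ.le)

/-- On the unit circle only `λ = 1` satisfies `F_λ(1) = 1`, by the equality case of the triangle
inequality for the greedy expansion of `1`. -/
lemma eq_one_of_norm_eq_one {β : ℝ} (hβ : 1 < β) {lam : ℂ} (hn : ‖lam‖ = 1)
    (hF : F β lam 1 = 1) : lam = 1 := by
  have h0 : 0 < β := by linarith
  have h1 : (1 : ℝ) ∈ Icc (0 : ℝ) 1 := ⟨zero_le_one, le_rfl⟩
  have hqn : ‖(β : ℂ) * lam‖ = β := by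
    rw [norm_mul, hn, mul_one, Complex.norm_real, Real.norm_of_nonneg h0.le]
  have hs := (summable_term hβ (by rw [hqn]; exact hβ) h1).hasSum (f := fun n : ℕ =>
    (digit β (n + 1) 1 : ℂ) / ((β : ℂ) * lam) ^ (n + 1))
  have hs1 := (summable_term hβ (q := (β : ℂ) * 1)
    (by rw [mul_one, Complex.norm_real, Real.norm_of_nonneg h0.le]; exact hβ) h1).hasSum
  change HasSum _ (F β lam 1) at hs
  change HasSum _ (F β 1 1) at hs1
  rw [hF] at hs
  rw [F_one_eq_self hβ h1] at hs1
  have hd := Complex.hasSum_re (hs1.sub hs)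
  simp only [Complex.ofReal_one, sub_self, Complex.zero_re, mul_one] at hd
  have hre : ∀ n : ℕ, ((digit β (n + 1) 1 : ℂ) / (β : ℂ) ^ (n + 1)).re
      = (digit β (n + 1) 1 : ℝ) / β ^ (n + 1) := fun n => by
    rw [← Complex.ofReal_re ((digit β (n + 1) 1 : ℝ) / β ^ (n + 1))]
    push_cast
    rfl
  have hnonneg : ∀ n : ℕ, 0 ≤ ((digit β (n + 1) 1 : ℂ) / (β : ℂ) ^ (n + 1)
      - (digit β (n + 1) 1 : ℂ) / ((β : ℂ) * lam) ^ (n + 1)).re := fun n => by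
    rw [Complex.sub_re, hre, sub_nonneg]
    refine (Complex.re_le_norm _).trans (le_of_eq ?_)
    rw [norm_div, norm_pow, hqn, Complex.norm_natCast]
  have h2 := congrFun ((hasSum_zero_iff_of_nonneg hnonneg).1 hd) 0
  rw [Complex.sub_re, hre] at h2
  have hd1 : (0 : ℝ) < digit β 1 1 := by exact_mod_cast digit_one_pos hβ
  have h3 : ((digit β 1 1 : ℂ) / ((β : ℂ) * lam)).re = digit β 1 1 / β * (lam⁻¹).re := by
    have : (digit β 1 1 : ℂ) / ((β : ℂ) * lam) = ((digit β 1 1 / β : ℝ) : ℂ) * lam⁻¹ := by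
      push_cast
      rw [div_mul_eq_div_div, div_eq_mul_inv _ lam]
    rw [this, Complex.re_ofReal_mul]
  simp only [zero_add, pow_one, Pi.zero_apply, h3] at h2
  have h4 : (lam⁻¹).re = 1 := by
    have hpos : 0 < (digit β 1 1 : ℝ) / β := by positivity
    nlinarith
  have h5 : ‖lam⁻¹‖ = 1 := by rw [norm_inv, hn, inv_one]
  have h6 : lam⁻¹ = 1 := by
    have := Complex.re_eq_norm.1 (show (lam⁻¹).re = ‖lam⁻¹‖ by rw [h4, h5])
    have him := (Complex.nonneg_iff.1 this).2
    exact Complex.ext h4 him.symm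
  exact inv_eq_one.1 h6

/-! ### Failure of pointwise Lipschitz bounds for `|λ| < 1` -/

/-- `f` satisfies a Lipschitz bound at `x` relative to `[0, 1]`, near `x`. -/
def LipschitzAt (f : ℝ → ℂ) (x : ℝ) : Prop :=
  ∃ C : ℝ, ∃ δ > 0, ∀ y ∈ Icc (0 : ℝ) 1, |y - x| < δ → ‖f y - f x‖ ≤ C * |y - x|

lemma digit_one_add_div {β : ℝ} (hβ : 1 < β) (a : ℕ) {t : ℝ} (ht : t ∈ Ico (0 : ℝ) 1) :
    digit β 1 ((a + t) / β) = a ∧ tau β ((a + t) / β) = t := by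
  have h0 : 0 < β := by linarith
  have e : β * ((a + t) / β) = a + t := mul_div_cancel₀ _ h0.ne'
  constructor
  · change ⌊β * ((a + t) / β)⌋₊ = a
    rw [e, Nat.floor_eq_iff (add_nonneg (Nat.cast_nonneg a) ht.1)]
    constructor <;> linarith [ht.1, ht.2]
  · rw [tau, e, Int.fract_natCast_add, Int.fract_eq_self.2 ⟨ht.1, ht.2⟩]

/-- The truncation `x - τ^n(x)/β^n` of the greedy expansion of `x` after `n` digits is greedy. -/
lemma truncation_spec {β : ℝ} (hβ : 1 < β) (n : ℕ) {x : ℝ} (hx : x ∈ Icc (0 : ℝ) 1) :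
    0 ≤ x - (tau β)^[n] x / β ^ n ∧
      (∀ k < n, digit β (k + 1) (x - (tau β)^[n] x / β ^ n) = digit β (k + 1) x) ∧
      (tau β)^[n] (x - (tau β)^[n] x / β ^ n) = 0 := by
  have h0 : 0 < β := by linarith
  induction n generalizing x with
  | zero => simp
  | succ n ih =>
    have ht := tau_mem_Icc β x
    obtain ⟨h1, h2, h3⟩ := ih ht
    set u := tau β x - (tau β)^[n] (tau β x) / β ^ n with hu
    have hu1 : u ∈ Ico (0 : ℝ) 1 := by
      refine ⟨h1, lt_of_le_of_lt (sub_le_self _ ?_) (Int.fract_lt_one (β * x))⟩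
      have := (iterate_tau_mem_Icc β ht n).1
      positivity
    have hfl : (digit β 1 x : ℝ) + tau β x = β * x := by
      change (⌊β * x⌋₊ : ℝ) + _ = _
      rw [tau, natCast_floor_eq_intCast_floor (mul_nonneg h0.le hx.1), Int.floor_add_fract]
    have e : x - (tau β)^[n + 1] x / β ^ (n + 1) = (digit β 1 x + u) / β := by
      rw [Function.iterate_succ_apply, hu, eq_div_iff h0.ne', ← add_sub_assoc, hfl, pow_succ]
      field_simp
    obtain ⟨hd, htau⟩ := digit_one_add_div hβ (digit β 1 x) hu1
    rw [e]
    refine ⟨div_nonneg (add_nonneg (Nat.cast_nonneg _) h1) h0.le, fun k hk => ?_, ?_⟩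
    · rcases k with _ | k
      · exact hd
      · have := h2 k (by omega)
        rw [digit_succ β k, digit_succ β k] at this
        rw [digit_succ β (k + 1), digit_succ β (k + 1), Function.iterate_succ_apply, htau, this,
          Function.iterate_succ_apply]
    · rw [Function.iterate_succ_apply, htau, h3]

/-- A Lipschitz bound at `x` forces the orbit of `x` to reach `0`: comparing `x` with its
truncations gives `F_λ(τ^n x) → 0`, so the digits of `x` tend to `0`. -/
lemma LipschitzAt.exists_iterate_eq_zero {β : ℝ} (hβ : 1 < β) {lam : ℂ} (hlam : 1 / β < ‖lam‖)
    (hlam1 : ‖lam‖ < 1) {x : ℝ} (hx : x ∈ Icc (0 : ℝ) 1) (h : LipschitzAt (F β lam) x) :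
    ∃ n, (tau β)^[n] x = 0 := by
  obtain ⟨C, δ, hδ, hC⟩ := h
  have h0 : 0 < β := by linarith
  have hq := one_lt_norm_mul hβ hlam
  have hq0 : (β : ℂ) * lam ≠ 0 := norm_pos_iff.1 (by linarith)
  have hqn : ‖(β : ℂ) * lam‖ = β * ‖lam‖ := by
    rw [norm_mul, Complex.norm_real, Real.norm_of_nonneg h0.le]
  have hpow : Tendsto (fun n : ℕ => β⁻¹ ^ n) atTop (𝓝 0) :=
    tendsto_pow_atTop_nhds_zero_of_lt_one (by positivity) (inv_lt_one_of_one_lt₀ hβ)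
  have hFlim : Tendsto (fun n : ℕ => F β lam ((tau β)^[n] x)) atTop (𝓝 0) := by
    have hb : Tendsto (fun n : ℕ => |C| * ‖lam‖ ^ n) atTop (𝓝 (|C| * 0)) :=
      (tendsto_pow_atTop_nhds_zero_of_lt_one (norm_nonneg _) hlam1).const_mul _
    rw [mul_zero] at hb
    refine squeeze_zero_norm' ?_ hb
    filter_upwards [hpow.eventually_lt_const hδ] with n hn
    have ht := iterate_tau_mem_Icc β hx n
    obtain ⟨hu0, hud, hut⟩ := truncation_spec hβ n hx
    set u := x - (tau β)^[n] x / β ^ n with hu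
    have hle : (tau β)^[n] x / β ^ n ≤ β⁻¹ ^ n := by
      rw [inv_pow, ← one_div]
      exact div_le_div_of_nonneg_right ht.2 (by positivity)
    have hnn : 0 ≤ (tau β)^[n] x / β ^ n := div_nonneg ht.1 (by positivity)
    have habs : |u - x| = (tau β)^[n] x / β ^ n := by
      rw [hu, sub_sub_cancel_left, abs_neg, abs_of_nonneg hnn]
    have huI : u ∈ Icc (0 : ℝ) 1 := ⟨hu0, (sub_le_self _ hnn).trans hx.2⟩
    have hmain := hC u huI (by rw [habs]; exact hle.trans_lt hn)
    rw [F_sub_F_of_prefix hβ hq hx huI hud, hut, F_zero, zero_sub, norm_div, norm_neg, norm_pow,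
      hqn, habs, div_le_iff₀ (pow_pos (by rw [← hqn]; linarith) n)] at hmain
    refine hmain.trans ?_
    calc C * ((tau β)^[n] x / β ^ n) * (β * ‖lam‖) ^ n
        ≤ |C| * β⁻¹ ^ n * (β * ‖lam‖) ^ n := by
          gcongr
          exact le_abs_self C
      _ = |C| * ‖lam‖ ^ n := by
          rw [mul_assoc, ← mul_pow, inv_mul_cancel_left₀ h0.ne']
  have hdig : Tendsto (fun n : ℕ => (digit β (n + 1) x : ℂ)) atTop (𝓝 0) := by
    have := (hFlim.mul_const ((β : ℂ) * lam)).sub (hFlim.comp (tendsto_add_atTop_nat 1))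
    rw [zero_mul, sub_zero] at this
    refine this.congr fun n => ?_
    rw [Function.comp_apply, F_eq_digit_add hβ hq (iterate_tau_mem_Icc β hx n),
      div_mul_cancel₀ _ hq0, Function.iterate_succ_apply', add_sub_cancel_right]
    rfl
  obtain ⟨N, hN⟩ := eventually_atTop.1
    (hdig.norm.eventually_lt_const (show ‖(0 : ℂ)‖ < 1 by simp))
  refine ⟨N, ?_⟩
  -- a point all of whose digits vanish is `0`
  have hzero : ∀ k, digit β (k + 1) ((tau β)^[N] x) = 0 := fun k => by
    have := hN (k + N) (by omega)
    rw [Complex.norm_natCast, Nat.cast_lt_one, digit_succ, Function.iterate_add_apply] at this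
    exact this
  have hself := F_one_eq_self hβ (iterate_tau_mem_Icc β hx N)
  rw [F] at hself
  simp only [hzero, Nat.cast_zero, zero_div, tsum_zero] at hself
  exact_mod_cast hself.symm

lemma F_inv_pow {β : ℝ} (hβ : 1 < β) {lam : ℂ} (hlam : 1 / β < ‖lam‖) (m : ℕ) :
    F β lam (β⁻¹ ^ (m + 1)) = (((β : ℂ) * lam) ^ (m + 1))⁻¹ := by
  have h0 : 0 < β := by linarith
  have hq := one_lt_norm_mul hβ hlam
  have hpow : ∀ m : ℕ, β⁻¹ ^ (m + 1) ∈ Ico (0 : ℝ) 1 := fun m =>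
    ⟨by positivity, pow_lt_one₀ (by positivity) (inv_lt_one_of_one_lt₀ hβ) (Nat.succ_ne_zero m)⟩
  induction m with
  | zero =>
    obtain ⟨hd, ht⟩ := digit_one_add_div hβ 1 (t := 0) ⟨le_rfl, one_pos⟩
    have e : β⁻¹ ^ (0 + 1) = ((1 : ℕ) + 0) / β := by simp
    rw [F_eq_digit_add hβ hq ⟨(hpow 0).1, (hpow 0).2.le⟩, e, hd, ht, F_zero]
    simp
  | succ m ih =>
    obtain ⟨hd, ht⟩ := digit_one_add_div hβ 0 (hpow m)
    have e : β⁻¹ ^ (m + 1 + 1) = ((0 : ℕ) + β⁻¹ ^ (m + 1)) / β := by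
      rw [pow_succ, Nat.cast_zero, zero_add, div_eq_mul_inv]
    rw [F_eq_digit_add hβ hq ⟨(hpow (m + 1)).1, (hpow (m + 1)).2.le⟩, e, hd, ht, ih,
      pow_succ _ (m + 1), mul_inv, Nat.cast_zero, zero_add, div_eq_mul_inv]

lemma not_eventually_pow_mul_le {r a C : ℝ} (hr : 1 < r) (ha : 0 < a)
    (h : ∀ᶠ m : ℕ in atTop, r ^ m * a ≤ C) : False := by
  obtain ⟨m, hm, hm'⟩ := (h.and (((tendsto_pow_atTop_atTop_of_one_lt hr).atTop_mul_const
    ha).eventually_gt_atTop C)).exists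
  exact absurd hm (not_le.2 hm')

/-- To the right of a point whose orbit reaches `0`, `F_λ` looks like `F_λ` at `0`, where the
increments `F_λ(β^{-m}) = (βλ)^{-m}` violate every Lipschitz bound. -/
lemma not_lipschitzAt_of_lt_one {β : ℝ} (hβ : 1 < β) {lam : ℂ} (hlam : 1 / β < ‖lam‖)
    (hlam1 : ‖lam‖ < 1) {x : ℝ} (hx : x ∈ Ico (0 : ℝ) 1) : ¬ LipschitzAt (F β lam) x := by
  intro h
  have h0 : 0 < β := by linarith
  have hx' : x ∈ Icc (0 : ℝ) 1 := ⟨hx.1, hx.2.le⟩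
  obtain ⟨N, hN⟩ := h.exists_iterate_eq_zero hβ hlam hlam1 hx'
  obtain ⟨C, δ, hδ, hC⟩ := h
  have hq := one_lt_norm_mul hβ hlam
  have hl0 : 0 < ‖lam‖ := (by positivity : (0 : ℝ) < 1 / β).trans hlam
  have hlim : Tendsto (fun m : ℕ => x + β⁻¹ ^ (N + (m + 1))) atTop (𝓝[≥] x) := by
    refine tendsto_nhdsWithin_iff.2 ⟨?_, Eventually.of_forall fun m =>
      le_add_of_nonneg_right (a := x) (b := β⁻¹ ^ (N + (m + 1))) (by positivity)⟩
    have h1 := (tendsto_pow_atTop_nhds_zero_of_lt_one (r := β⁻¹) (by positivity)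
      (inv_lt_one_of_one_lt₀ hβ)).comp (tendsto_add_atTop_nat (N + 1))
    have h2 := h1.const_add x
    rw [add_zero] at h2
    refine h2.congr fun m => ?_
    rw [Function.comp_apply]
    congr 2
    omega
  refine not_eventually_pow_mul_le (r := ‖lam‖⁻¹) (a := (‖lam‖⁻¹) ^ (N + 1)) (C := C)
    ((one_lt_inv₀ hl0).2 hlam1) (by positivity) ?_
  filter_upwards [hlim.eventually (eventually_prefix_nhdsGE hβ x N),
    hlim.eventually (nhdsWithin_le_nhds (gt_mem_nhds hx.2)),
    hlim.eventually (nhdsWithin_le_nhds (Metric.ball_mem_nhds x hδ))] with m hm hm1 hmδ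
  have hpos : 0 < β⁻¹ ^ (N + (m + 1)) := by positivity
  set y := x + β⁻¹ ^ (N + (m + 1)) with hy
  have hyI : y ∈ Icc (0 : ℝ) 1 := ⟨add_nonneg hx.1 hpos.le, hm1.le⟩
  have habs : |y - x| = β⁻¹ ^ (N + (m + 1)) := by
    rw [hy, add_sub_cancel_left, abs_of_pos hpos]
  have hit : (tau β)^[N] y = β⁻¹ ^ (m + 1) := by
    rw [hm.2, hN, hy, add_sub_cancel_left, zero_add, pow_add, ← mul_assoc, ← mul_pow,
      mul_inv_cancel₀ h0.ne', one_pow, one_mul]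
  have hmain := hC y hyI (by rw [← Real.dist_eq]; exact hmδ)
  rw [F_sub_F_of_prefix hβ hq hx' hyI hm.1, hit, hN, F_zero, sub_zero, F_inv_pow hβ hlam, habs,
    norm_div, norm_inv, norm_pow, norm_pow, norm_mul, Complex.norm_real,
    Real.norm_of_nonneg h0.le, mul_pow, mul_pow, inv_pow] at hmain
  rw [← pow_add, inv_pow, show m + (N + 1) = N + (m + 1) by omega]
  refine le_of_mul_le_mul_right ?_ (inv_pos.2 (pow_pos h0 (N + (m + 1))))
  refine le_trans (le_of_eq ?_) hmain
  field_simp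
  ring

/-- At `x = 1` the orbit may reach `0` without right neighbours; there the self-similarity of `F_λ`
on the left of `1` takes over. -/
lemma not_lipschitzAt {β : ℝ} (hβ : 1 < β) {lam : ℂ} (hlam : 1 / β < ‖lam‖)
    (hlam1 : ‖lam‖ < 1) (hF1 : F β lam 1 = 1) {x : ℝ} (hx : x ∈ Icc (0 : ℝ) 1) :
    ¬ LipschitzAt (F β lam) x := by
  rcases hx.2.lt_or_eq with hlt | rfl
  · exact not_lipschitzAt_of_lt_one hβ hlam hlam1 ⟨hx.1, hlt⟩
  intro h
  have h0 : 0 < β := by linarith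
  have hq := one_lt_norm_mul hβ hlam
  have hl0 : 0 < ‖lam‖ := (by positivity : (0 : ℝ) < 1 / β).trans hlam
  obtain ⟨n, hn⟩ := h.exists_iterate_eq_zero hβ hlam hlam1 hx
  obtain ⟨N, hN⟩ := exists_hitsZeroAfter one_ne_zero hn
  obtain ⟨C, δ, hδ, hC⟩ := h
  have hev := hN.eventually_F_sub hβ hq ⟨one_pos, le_rfl⟩
  rw [hF1] at hev
  obtain ⟨a, ha, haev⟩ := (mem_nhdsLT_iff_exists_Ioo_subset' (zero_lt_one' ℝ)).1
    (hev.and (Ioo_mem_nhdsLT (show max 0 (1 - δ) < 1 from max_lt one_pos (by linarith))))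
  have haev' : ∀ y ∈ Ioo a 1, F β lam y - 1
      = (F β lam (1 - β ^ (N + 1) * (1 - y)) - 1) / ((β : ℂ) * lam) ^ (N + 1) ∧
      0 < y ∧ 1 - δ < y := fun y hy =>
    ⟨(haev hy).1, (max_lt_iff.1 (haev hy).2.1).1, (max_lt_iff.1 (haev hy).2.1).2⟩
  -- `F_λ` is not constant near `1`, as it is not Lipschitz at points below `1`
  have hne : ∃ y ∈ Ioo a 1, F β lam y ≠ 1 := by
    by_contra! hconst
    have hmid : (a + 1) / 2 ∈ Ioo a 1 := by
      have : a < 1 := ha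
      constructor <;> linarith
    refine not_lipschitzAt_of_lt_one hβ hlam hlam1 ⟨(haev' _ hmid).2.1.le, hmid.2⟩
      ⟨0, (1 - a) / 2, by linarith [hmid.1, hmid.2], fun y _ hy => ?_⟩
    rw [abs_lt] at hy
    rw [hconst _ hmid, hconst y ⟨by linarith, by linarith⟩]
    simp
  obtain ⟨y, hy, hFy⟩ := hne
  set b := β ^ (N + 1) with hb
  have hb1 : 1 < b := one_lt_pow₀ hβ (Nat.succ_ne_zero N)
  have hb0 : 0 < b := by linarith
  have hy1 : 0 < 1 - y := sub_pos.2 hy.2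
  have hmem : ∀ m : ℕ, 1 - b⁻¹ ^ m * (1 - y) ∈ Ioo a 1 := fun m => by
    have h1 : b⁻¹ ^ m ≤ 1 := pow_le_one₀ (by positivity) (inv_le_one_of_one_le₀ hb1.le)
    have h2 : 0 < b⁻¹ ^ m * (1 - y) := by positivity
    have h3 : b⁻¹ ^ m * (1 - y) ≤ 1 - y := mul_le_of_le_one_left hy1.le h1
    exact ⟨by linarith [hy.1], by linarith⟩
  have hscale : ∀ m : ℕ, F β lam (1 - b⁻¹ ^ m * (1 - y)) - 1
      = (F β lam y - 1) / (((β : ℂ) * lam) ^ (N + 1)) ^ m := by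
    intro m
    induction m with
    | zero => simp
    | succ m ih =>
      have e : 1 - b * (1 - (1 - b⁻¹ ^ (m + 1) * (1 - y))) = 1 - b⁻¹ ^ m * (1 - y) := by
        rw [pow_succ]
        field_simp
        ring
      rw [(haev' _ (hmem (m + 1))).1, e, ih, div_div, ← pow_succ]
  refine not_eventually_pow_mul_le (r := ‖lam‖⁻¹ ^ (N + 1)) (a := ‖F β lam y - 1‖) (C := C * (1 - y))
    (one_lt_pow₀ ((one_lt_inv₀ hl0).2 hlam1) (Nat.succ_ne_zero N))
    (norm_pos_iff.2 (sub_ne_zero.2 hFy)) (Eventually.of_forall fun m => ?_)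
  have hm := hmem m
  have hpos : 0 < b⁻¹ ^ m * (1 - y) := by positivity
  have habs : |1 - b⁻¹ ^ m * (1 - y) - 1| = b⁻¹ ^ m * (1 - y) := by
    rw [sub_sub_cancel_left, abs_neg, abs_of_pos hpos]
  have hmain := hC _ ⟨(haev' _ hm).2.1.le, hm.2.le⟩
    (by rw [habs]; linarith [(haev' _ hm).2.2])
  rw [habs, hF1, hscale, norm_div, norm_pow, norm_pow, norm_mul, Complex.norm_real,
    Real.norm_of_nonneg h0.le, mul_pow, ← hb, mul_pow] at hmain
  refine le_of_mul_le_mul_right ?_ (inv_pos.2 (pow_pos hb0 m))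
  calc _ = ‖F β lam y - 1‖ / (b ^ m * (‖lam‖ ^ (N + 1)) ^ m) := by
        rw [inv_pow, inv_pow]
        field_simp
    _ ≤ _ := hmain
    _ = _ := by rw [inv_pow]; ring

end BetaMap

open BetaMap in
theorem theorem4p3 (β : ℝ) (hβ : 1 < β) (lam : ℂ) (hlam : 1 / β < ‖lam‖) (hlam' : ‖lam‖ ≤ 1) :
    -- right-continuity on `[0, 1)`
    (∀ x ∈ Set.Ico (0 : ℝ) 1, ContinuousWithinAt (F β lam) (Set.Icc x 1) x) ∧
    -- left-continuity at the non-simple points of `(0, 1]`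
    (∀ x ∈ Set.Ioc (0 : ℝ) 1, ¬ IsSimplePoint β x →
      ContinuousWithinAt (F β lam) (Set.Icc 0 x) x) ∧
    -- left-continuity at the simple points of `(0, 1]`, at all of them and at any one of them
    ((∀ x ∈ Set.Ioc (0 : ℝ) 1, IsSimplePoint β x →
        ContinuousWithinAt (F β lam) (Set.Icc 0 x) x) ↔
      IsIsolatedEigenvalue (perronFrobenius β hβ) lam) ∧
    (∀ x ∈ Set.Ioc (0 : ℝ) 1, IsSimplePoint β x →
      (ContinuousWithinAt (F β lam) (Set.Icc 0 x) x ↔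
        IsIsolatedEigenvalue (perronFrobenius β hβ) lam)) ∧
    -- the leading eigenvalue
    (lam = 1 → (∀ x ∈ Set.Icc (0 : ℝ) 1, F β lam x = (x : ℂ)) ∧
      DifferentiableOn ℝ (F β lam) (Set.Icc 0 1)) ∧
    -- non-leading eigenvalues
    (IsNonLeadingEigenvalue β hβ lam →
      (¬ ∃ K : NNReal, LipschitzOnWith K (F β lam) (Set.Icc 0 1)) ∧
      (∀ x ∈ Set.Icc (0 : ℝ) 1, ¬ ∃ C : ℝ, ∃ δ > 0, ∀ y ∈ Set.Icc (0 : ℝ) 1,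
        |y - x| < δ → ‖F β lam y - F β lam x‖ ≤ C * |y - x|) ∧
      (∀ x ∈ Set.Icc (0 : ℝ) 1, ¬ DifferentiableWithinAt ℝ (F β lam) (Set.Icc 0 1) x)) := by
  have h0 : 0 < β := by linarith
  have hq := one_lt_norm_mul hβ hlam
  have hsimple : ∀ x ∈ Set.Ioc (0 : ℝ) 1, IsSimplePoint β x →
      (ContinuousWithinAt (F β lam) (Set.Icc 0 x) x ↔
        IsIsolatedEigenvalue (perronFrobenius β hβ) lam) := by
    intro x hx hs
    obtain ⟨N, hN⟩ := (isSimplePoint_iff hβ hx).1 hs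
    rw [hN.continuousWithinAt_iff hβ hq hx, tendsto_F_one_left_iff hβ hq,
      isIsolatedEigenvalue_iff hβ hlam]
  refine ⟨fun x hx => continuousWithinAt_F_right hβ hq ⟨hx.1, hx.2.le⟩, fun x hx hs =>
    continuousWithinAt_F_left_of_ne hβ hq ⟨hx.1.le, hx.2⟩
      (iterate_ne_zero_of_not_isSimplePoint hβ hx hs), ⟨fun h => ?_, fun h x hx hs =>
    (hsimple x hx hs).2 h⟩, hsimple, ?_, ?_⟩
  · -- `1/β` is a simple point
    have hx : β⁻¹ ∈ Set.Ioc (0 : ℝ) 1 := ⟨by positivity, inv_le_one_of_one_le₀ hβ.le⟩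
    have hs : IsSimplePoint β β⁻¹ :=
      ⟨0, 1, Finset.mem_Icc.2 ⟨le_rfl, Nat.le_floor (by simpa using hβ.le)⟩, by simp⟩
    exact (hsimple _ hx hs).1 (h _ hx hs)
  · rintro rfl
    refine ⟨fun x hx => F_one_eq_self hβ hx, ?_⟩
    exact Complex.ofRealCLM.differentiable.differentiableOn.congr fun x hx => F_one_eq_self hβ hx
  · rintro ⟨hev, -, hne⟩
    have hF1 := (isIsolatedEigenvalue_iff hβ hlam).1 hev
    have hlt : ‖lam‖ < 1 := lt_of_le_of_ne hlam' fun h => hne (eq_one_of_norm_eq_one hβ h hF1)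
    have hnot : ∀ x ∈ Set.Icc (0 : ℝ) 1, ¬ LipschitzAt (F β lam) x := fun x hx =>
      not_lipschitzAt hβ hlam hlt hF1 hx
    refine ⟨?_, hnot, ?_⟩
    · rintro ⟨K, hK⟩
      have h1 : (0 : ℝ) ∈ Set.Icc (0 : ℝ) 1 := ⟨le_rfl, zero_le_one⟩
      refine hnot 0 h1 ⟨K, 1, one_pos, fun y hy _ => ?_⟩
      rw [← dist_eq_norm, ← Real.dist_eq]
      exact hK.dist_le_mul y hy 0 h1
    · intro x hx hd
      obtain ⟨C, hC⟩ := hd.isBigO_sub.bound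
      obtain ⟨δ, hδ, hball⟩ := Metric.mem_nhdsWithin_iff.1 hC
      refine hnot x hx ⟨C, δ, hδ, fun y hy hyδ => ?_⟩
      have := hball ⟨by rw [Metric.mem_ball, Real.dist_eq]; exact hyδ, hy⟩
      exact this
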